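/- Work over $\mathbb{C}$. Let $W$ be a finite-dimensional vector space and let $\mathbf F=\bigoplus_{k\ge 0}F^k\subset \operatorname{Sym}(W^*)$ be a symbol system of rank $2$, that is, $F^k\subset \operatorname{Sym}^kW^*$, $F^0=\mathbb{C}$, $F^1=W^*$, $F^2\neq 0$, and $F^k=0$ for $k\ge 3$ (the prolongation condition, that all contractions $\iota_w\varphi$ of $\varphi\in F^{k+1}$ lie in $F^k$ for $k\ge1$, is then part of the definition). Suppose that $F^2=\langle Q_1,\dots,Q_c\rangle$ with $\dim F^2=c$. Put $V_{\mathbf F}=\mathbb{C}\oplus W\oplus (F^2)^*$ and let $M(\mathbf F)\subset\mathbb{P}V_{\mathbf F}$ be the associated Euler-symmetric variety, i.e. the Zariski closure of the image of the rational map $\mathbb{P}(\mathbb{C}\oplus W)\dashrightarrow\mathbb{P}V_{\mathbf F}$, $[t:w]\mapsto[t^2:tw:\iota_w^2]$, where $\iota_w^2\in(F^2)^*$ is evaluation at $w$. Let $\mathbf{Bs}(\mathbf F)=V(Q_1,\dots,Q_c)\subset\mathbb{P}W$, and for $x\in M(\mathbf F)$ let $\mathcal{L}_x(M(\mathbf F))\subset\mathbb{P}T_xM(\mathbf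 F)$ be the variety of lines through $x$, i.e. the set of tangent directions at $x$ of the lines in $\mathbb{P}V_{\mathbf F}$ that contain $x$ and are contained in $M(\mathbf F)$. For a subset $Z\subset\mathbb{P}^N$ that is algebraic, let $I(Z)$ be its homogeneous vanishing ideal, and say that $Z$ has codimension $c$ if $\dim Z=N-c$, with $\dim\emptyset=-1$. Call $Z$ a complete intersection of codimension $c$ if it has codimension $c$ and $I(Z)$ can be generated by $c$ elements, and a set-theoretic complete intersection of codimension $c$ if it has codimension $c$ and is the intersection of $c$ hypersurfaces; in particular the empty set is a set-theoretic complete intersection of codimension $N+1$. Then the following statements are equivalent: 1. $M(\mathbf F)$ is a complete intersection of codimension $c$ in $\mathbb{P}V_{\mathbf F}$; 2. $\mathbf{Bs}(\mathbf F)\subset\mathbb{P}W$ is a set-theoretic complete intersection of codimension $c$; 3. for a general point $x\in M(\mathbf F)$ (i.e. for all $x$ in some dense Zariski-open subset of $M(\mathbf F)$), $\mathcal{L}_x(M(\mathbf F))\subset\mathbb{P}T_xM(\mathbf F)$ is a set-theoretic complete intersection of codimension $c$; 4. $(Q_1,\dots,Q_c)$ is a regular sequence in $\operatorname{Sym}(W^*)$,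 i.e. $Q_i$ is not a zero-divisor on $\operatorname{Sym}(W^*)/(Q_1,\dots,Q_{i-1})$ for $i=1,\dots,c$. -/

import Mathlib

noncomputable section

namespace EulerSym

open Module

section Polynomials

variable {V : Type*} [AddCommGroup V] [Module ℂ V]

variable (V) in
/-- `Sym(V^*)`, the ring of polynomials on the complex vector space `V`; for finite-dimensional `V`
it is the homogeneous coordinate ring of `ℙV`. -/
abbrev PolyRing : Type _ := SymmetricAlgebra ℂ (Dual ℂ V)

variable (V) in
/-- `Sym^k(V^*)`, the homogeneous polynomials of degree `k` on `V`: the span of all products of `k`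
linear forms. -/
def symPow (k : ℕ) : Submodule ℂ (PolyRing V) :=
  LinearMap.range (SymmetricAlgebra.ι ℂ (Dual ℂ V)) ^ k

/-- Evaluation of polynomials at the point `v`. -/
def evalAt (v : V) : PolyRing V →ₐ[ℂ] ℂ :=
  SymmetricAlgebra.lift (Dual.eval ℂ V v)

/-- The algebra homomorphism `f ↦ f(x + ε u)` with values in the dual numbers over `Sym(V^*)`. -/
def taylorOne (u : V) : PolyRing V →ₐ[ℂ] DualNumber (PolyRing V) :=
  SymmetricAlgebra.lift
    ((TrivSqZeroExt.inlAlgHom ℂ (PolyRing V) (PolyRing V)).toLinearMap ∘ₗ SymmetricAlgebra.ι ℂ (Dual ℂ V) +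
      ((TrivSqZeroExt.inrHom (PolyRing V) (PolyRing V)).restrictScalars ℂ) ∘ₗ
        (Algebra.linearMap ℂ (PolyRing V)) ∘ₗ Dual.eval ℂ V u)

theorem fst_taylorOne (u : V) (f : PolyRing V) : (taylorOne u f).fst = f := by
  have : (TrivSqZeroExt.fstHom ℂ (PolyRing V) (PolyRing V)).comp (taylorOne u) = AlgHom.id ℂ (PolyRing V) := by
    apply SymmetricAlgebra.algHom_ext
    ext l
    simp [taylorOne]
  exact DFunLike.congr_fun this f

/-- The directional derivative `∂_u` on `Sym(V^*)`: the coefficient of `ε` in `f(x + ε u)`. -/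
def dirDeriv (u : V) : Derivation ℂ (PolyRing V) (PolyRing V) :=
  Derivation.mk'
    (((TrivSqZeroExt.sndHom (PolyRing V) (PolyRing V)).restrictScalars ℂ) ∘ₗ (taylorOne u).toLinearMap)
    (by
      intro a b
      simp [fst_taylorOne, mul_comm])

theorem dirDeriv_ι (u : V) (l : Dual ℂ V) :
    dirDeriv u (SymmetricAlgebra.ι ℂ (Dual ℂ V) l) = algebraMap ℂ (PolyRing V) (l u) := by
  simp [dirDeriv, taylorOne, Algebra.algebraMap_eq_smul_one]

theorem derivation_ext {D E : Derivation ℂ (PolyRing V) (PolyRing V)}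
    (h : ∀ l : Dual ℂ V, D (SymmetricAlgebra.ι ℂ (Dual ℂ V) l) =
      E (SymmetricAlgebra.ι ℂ (Dual ℂ V) l)) : D = E := by
  ext f
  induction f using SymmetricAlgebra.induction with
  | algebraMap r => simp
  | ι x => exact h x
  | mul a b ha hb => simp [ha, hb]
  | add a b ha hb => simp [ha, hb]

theorem dirDeriv_add (u u' : V) : dirDeriv (u + u') = dirDeriv u + dirDeriv u' :=
  derivation_ext fun l => by simp [dirDeriv_ι]

theorem dirDeriv_smul (a : ℂ) (u : V) : dirDeriv (a • u) = a • dirDeriv u :=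
  derivation_ext fun l => by simp [dirDeriv_ι, Algebra.smul_def]

theorem dirDeriv_zero : dirDeriv (0 : V) = 0 :=
  derivation_ext fun l => by simp [dirDeriv_ι]

/-- The contraction `ι_w : Sym^(k+1)(W^*) → Sym^k(W^*)`. If `φ` is a symmetric multilinear form and
`f(x) = φ(x, …, x)` the corresponding polynomial of degree `k + 1`, then
`φ(w, x, …, x) = (∂_w f)(x) / (k + 1)`. -/
def contract (k : ℕ) (w : V) : PolyRing V →ₗ[ℂ] PolyRing V :=
  ((k : ℂ) + 1)⁻¹ • (dirDeriv w : PolyRing V →ₗ[ℂ] PolyRing V)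

/-- The prolongation of a subspace `F` of `Sym^k(V^*)`: all `φ` in `Sym^(k+1)(V^*)` whose
contractions all lie in `F`. -/
def prolong (k : ℕ) (F : Submodule ℂ (PolyRing V)) : Submodule ℂ (PolyRing V) :=
  symPow V (k + 1) ⊓ ⨅ w : V, F.comap (contract k w)

end Polynomials

section Projective

variable {V : Type*} [AddCommGroup V] [Module ℂ V]

/-- The projective algebraic set in `ℙV` defined by a set of polynomials: the lines in `V` on which
all of them vanish. -/
def zeroLocus (s : Set (PolyRing V)) : Set (Projectivization ℂ V) :=
  {p | ∀ f ∈ s, ∀ v ∈ p.submodule, evalAt v f = 0}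

/-- The affine cone in `V` over a subset of `ℙV`; it always contains the origin. -/
def affineCone (Z : Set (Projectivization ℂ V)) : Set V :=
  {v | v = 0 ∨ ∃ p ∈ Z, v ∈ p.submodule}

/-- The homogeneous ideal `I(Z)` of all polynomials vanishing on the affine cone over `Z`
(for `Z = ∅` it is the irrelevant ideal). -/
def vanishingIdeal (Z : Set (Projectivization ℂ V)) : Ideal (PolyRing V) where
  carrier := {f | ∀ v ∈ affineCone Z, evalAt v f = 0}
  add_mem' := by
    intro f g hf hg v hv
    simp [hf v hv, hg v hv]
  zero_mem' := by
    intro v _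
    simp
  smul_mem' := by
    intro a f hf v hv
    simp [hf v hv]

/-- The Zariski closure of a subset of `ℙV`. -/
def zariskiClosure (Z : Set (Projectivization ℂ V)) : Set (Projectivization ℂ V) :=
  zeroLocus (vanishingIdeal Z : Set (PolyRing V))

/-- `Z ⊆ ℙV` has codimension `c`, i.e. `dim Z + c = dim ℙV`, where `dim Z + 1` is the Krull
dimension of the homogeneous coordinate ring of `Z` (so `dim ∅ = -1`). -/
def HasCodim (Z : Set (Projectivization ℂ V)) (c : ℕ) : Prop :=
  ringKrullDim (PolyRing V ⧸ vanishingIdeal Z) + (c : WithBot ℕ∞) = ((finrank ℂ V : ℕ) : WithBot ℕ∞)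

/-- `Z ⊆ ℙV` is a complete intersection of codimension `c`. -/
def IsCompleteIntersection (Z : Set (Projectivization ℂ V)) (c : ℕ) : Prop :=
  HasCodim Z c ∧ ∃ g : Fin c → PolyRing V, vanishingIdeal Z = Ideal.span (Set.range g)

/-- `Z ⊆ ℙV` is a set-theoretic complete intersection of codimension `c`: it has codimension `c`
and is the intersection of `c` hypersurfaces. -/
def IsSetTheoreticCompleteIntersection (Z : Set (Projectivization ℂ V)) (c : ℕ) : Prop :=
  HasCodim Z c ∧ ∃ g : Fin c → PolyRing V,
    (∀ i, ∃ d : ℕ, 1 ≤ d ∧ g i ∈ symPow V d) ∧ Z = zeroLocus (Set.range g)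

/-- A property holds at a general point of `Z ⊆ ℙV` if it holds on some Zariski-open dense subset
of `Z`. -/
def ForGeneralPoint (Z : Set (Projectivization ℂ V)) (P : Projectivization ℂ V → Prop) : Prop :=
  ∃ s : Set (PolyRing V), Z ⊆ zariskiClosure (Z \ zeroLocus s) ∧ ∀ x ∈ Z \ zeroLocus s, P x

/-- The embedded tangent space of `Z` at `x`, as a linear subspace of `V`: the common kernel of the
differentials at the points of the line `x` of all polynomials in `I(Z)`. -/
def embeddedTangentSpace (Z : Set (Projectivization ℂ V)) (x : Projectivization ℂ V) :
    Submodule ℂ V where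
  carrier := {u | ∀ f ∈ vanishingIdeal Z, ∀ v ∈ x.submodule, evalAt v (dirDeriv u f) = 0}
  add_mem' := by
    intro a b ha hb f hf v hv
    simp [dirDeriv_add, ha f hf v hv, hb f hf v hv]
  zero_mem' := by
    intro f _ v _
    simp [dirDeriv_zero]
  smul_mem' := by
    intro a b hb f hf v hv
    simp [dirDeriv_smul, hb f hf v hv]

/-- The tangent space `T_x Z`, up to the usual twist by the line `x`: the embedded tangent space
modulo the line `x`. -/
abbrev TangentSpaceAt (Z : Set (Projectivization ℂ V)) (x : Projectivization ℂ V) : Type _ :=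
  embeddedTangentSpace Z x ⧸ x.submodule.comap (embeddedTangentSpace Z x).subtype

/-- The variety of lines `ℒ_x(Z) ⊆ ℙ(T_x Z)`: the tangent directions at `x` of the lines in `ℙV`
that pass through `x` and are contained in `Z`. A line is a two-dimensional subspace `L` of `V`. -/
def varietyOfLines (Z : Set (Projectivization ℂ V)) (x : Projectivization ℂ V) :
    Set (Projectivization ℂ (TangentSpaceAt Z x)) :=
  {p | ∃ L : Submodule ℂ V, finrank ℂ L = 2 ∧ x.submodule ≤ L ∧
    (∀ y : Projectivization ℂ V, y.submodule ≤ L → y ∈ Z) ∧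
    p.submodule = (L.comap (embeddedTangentSpace Z x).subtype).map
      (x.submodule.comap (embeddedTangentSpace Z x).subtype).mkQ}

end Projective

/-- A symbol system of rank `r` on `W`; `comp k` is the component `F^k ⊆ Sym^k(W^*)`. -/
structure SymbolSystem (W : Type*) [AddCommGroup W] [Module ℂ W] (r : ℕ) where
  comp : ℕ → Submodule ℂ (PolyRing W)
  comp_le : ∀ k, comp k ≤ symPow W k
  comp_zero : comp 0 = symPow W 0
  comp_one : comp 1 = symPow W 1
  comp_rank : comp r ≠ ⊥
  comp_rank_add : ∀ i, 1 ≤ i → comp (r + i) = ⊥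
  comp_succ_le : ∀ k, 1 ≤ k → k ≤ r → comp (k + 1) ≤ prolong k (comp k)

namespace SymbolSystem

variable {W : Type*} [AddCommGroup W] [Module ℂ W]

/-- The space `V_F = ℂ ⊕ W ⊕ (F^2)^*` of a symbol system of rank two. -/
abbrev ambient (F : SymbolSystem W 2) : Type _ :=
  ℂ × W × Dual ℂ (F.comp 2)

/-- The map `(t, w) ↦ (t^2, t w, ι_w^2)`, where `ι_w^2 ∈ (F^2)^*` is evaluation at `w`. -/
def phi (F : SymbolSystem W 2) (t : ℂ) (w : W) : F.ambient :=
  (t ^ 2, t • w, (evalAt w).toLinearMap.domRestrict (F.comp 2))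

/-- The Euler-symmetric variety `M(F) ⊆ ℙV_F`: the Zariski closure of the image of the rational map
`[t : w] ↦ [t^2 : t w : ι_w^2]`. -/
def variety (F : SymbolSystem W 2) : Set (Projectivization ℂ F.ambient) :=
  zariskiClosure {p | ∃ (t : ℂ) (w : W) (h : F.phi t w ≠ 0), p = Projectivization.mk ℂ (F.phi t w) h}

end SymbolSystem

end EulerSym

end

/-!
# Euler-symmetric varieties of rank two that are complete intersections

The coordinates on `V_F = ℂ ⊕ W ⊕ (F^2)^*` are `t`, `w` and `y_q` for `q ∈ F^2`. The variety
`M(F)` lies on the quadrics `t y_q - q(w)`, and away from `t = 0` it is the graph of the quadratic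
map `w ↦ ι_w^2`. Every condition is compared with the regularity of `Q_1, …, Q_c`.

The algebraic input is the Cohen–Macaulay property of the polynomial ring
(`isWeaklyRegular_iff_ringKrullDim_add_length`): forms `f_1, …, f_m` of positive degree are a
regular sequence if and only if the quotient by them has codimension `m`. In particular regularity
depends only on the ideal that the forms generate and on their number. By the Nullstellensatz, the
base locus has codimension `c` if and only if `Q_1, …, Q_c` is regular.

For the ideal of `M(F)`, consider the sequence of the `t y_{Q_i} - Q_i(w)`, followed by `t`. It
generates the same ideal as the `Q_i(w)` together with `t`, so it is regular if and only if `Q_1, …,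
Q_c` is. If it is regular, then `t` is a nonzerodivisor modulo the quadrics; as inverting `t`
eliminates the `y_q`, the quadrics generate the ideal of `M(F)`
(`vanishingIdeal_variety_eq_quadIdeal_of_tForm_regular`). Conversely, let the ideal `I` of `M(F)`
have `c` generators. No element of `I` has a linear term, so the space of quadrics `t y_q - q(w)`,
of dimension `c`, meets `m I` trivially, where `m` is the ideal of the origin. By Nakayama's lemma
the quadrics generate `I` (`vanishingIdeal_variety_eq_quadIdeal_of_span`). If `M(F)` has codimension
`c`, they form a regular sequence, and `t` is a nonzerodivisor modulo `I`.

For the lines, the differential of the parametrization identifies `W` with the tangent space at a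
point with `t ≠ 0`, and a direction `b` is tangent to a line in `M(F)` if and only if all quadrics
in `F^2` vanish at `b` (`tangentEquiv_mem_affineCone_varietyOfLines_iff`): the variety of lines is
projectively equivalent to the base locus.
-/

noncomputable section

namespace EulerSym

open Module RingTheory.Sequence

/-! ### Depth and dimension over a Noetherian local ring -/

section Depth

open IsLocalRing CategoryTheory Abelian Pointwise

universe u

variable {R : Type u} [CommRing R]

theorem supportDim_mono {M N : Type*} [AddCommGroup M] [Module R M] [AddCommGroup N] [Module R N]
    (h : support R M ⊆ support R N) : supportDim R M ≤ supportDim R N :=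
  Order.krullDim_le_of_strictMono (fun a => ⟨a.1, h a.2⟩) fun {_ _} lt => lt

variable [IsNoetherianRing R] [IsLocalRing R]

/-- If `x` is a nonzerodivisor on `M`, every associated prime of `M` lies, together with `x`, in an
associated prime of `M ⧸ xM`. -/
theorem exists_associatedPrimes_quotSMulTop_of_isSMulRegular {M : Type u} [AddCommGroup M]
    [Module R M] [Module.Finite R M] {x : R} (hx : x ∈ maximalIdeal R) (hreg : IsSMulRegular M x)
    {p : Ideal R} (hp : p ∈ associatedPrimes R M) :
    ∃ p' ∈ associatedPrimes R (QuotSMulTop x M), p ≤ p' ∧ x ∈ p' := by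
  -- The submodule `N` of elements killed by `p` is not contained in `xM`, by Nakayama's lemma.
  let N : Submodule R M := Submodule.torsionBySet R M (p : Set R)
  have hNmem (m : M) : m ∈ N ↔ ∀ a ∈ p, a • m = 0 := by
    simp [N, Submodule.mem_torsionBySet_iff]
  have hN : N ≠ ⊥ := by
    obtain ⟨hp1, m, hm⟩ := isAssociatedPrime_iff.1 hp
    intro h0
    have hm0 : m ∈ N := (hNmem m).2 fun a ha => by
      rw [hm] at ha
      simpa using ha
    rw [h0, Submodule.mem_bot] at hm0
    apply hp1.ne_top
    simp [hm, hm0]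
  have hNx : ¬ N ≤ x • (⊤ : Submodule R M) := by
    intro hle
    apply hN
    apply Submodule.eq_bot_of_le_smul_of_le_jacobson_bot (Ideal.span {x}) N
      (IsNoetherian.noetherian N)
    · intro n hn
      obtain ⟨m, -, rfl⟩ := (Submodule.mem_smul_pointwise_iff_exists _ _ _).1 (hle hn)
      refine Submodule.smul_mem_smul (Ideal.mem_span_singleton_self x) ?_
      rw [hNmem] at hn ⊢
      intro a ha
      apply hreg
      simpa [smul_comm a x] using hn a ha
    · rw [Ideal.span_singleton_le_iff_mem]
      exact maximalIdeal_le_jacobson _ hx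
  obtain ⟨n, hn, hnx⟩ := SetLike.not_le_iff_exists.1 hNx
  have hne : (Submodule.Quotient.mk n : QuotSMulTop x M) ≠ 0 := by
    rwa [Ne, Submodule.Quotient.mk_eq_zero]
  obtain ⟨p', hp', hle⟩ := exists_le_isAssociatedPrime_of_isNoetherianRing R _ hne
  refine ⟨p', hp', fun a ha => hle ?_, hle ?_⟩
  · rw [Submodule.mem_colon_singleton, ← Submodule.Quotient.mk_smul, (hNmem n).1 hn a ha]
    simp
  · rw [Submodule.mem_colon_singleton, ← Submodule.Quotient.mk_smul, Submodule.mem_bot,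
      Submodule.Quotient.mk_eq_zero]
    exact Submodule.smul_mem_pointwise_smul _ _ _ trivial

/-- The depth of `M` is at most the dimension of `R ⧸ p` for every associated prime `p` of `M`. -/
theorem length_le_supportDim_of_mem_associatedPrimes {M : Type u} [AddCommGroup M]
    [Module R M] [Module.Finite R M] {rs : List R} (hrs : IsRegular M rs)
    (hmem : ∀ r ∈ rs, r ∈ maximalIdeal R) {p : Ideal R} (hp : p ∈ associatedPrimes R M) :
    (rs.length : WithBot ℕ∞) ≤ supportDim R (R ⧸ p) := by
  induction rs generalizing M p with
  | nil =>
    have : Nontrivial (R ⧸ p) := Ideal.Quotient.nontrivial_iff.2 hp.1.ne_top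
    obtain ⟨d, hd⟩ := WithBot.ne_bot_iff_exists.1 (supportDim_ne_bot_of_nontrivial R (R ⧸ p))
    rw [← hd]
    exact WithBot.coe_le_coe.2 (by simp)
  | cons x rs ih =>
    rw [isRegular_cons_iff] at hrs
    have hxm : x ∈ maximalIdeal R := hmem x (by simp)
    obtain ⟨p', hp', hle, hxp'⟩ := exists_associatedPrimes_quotSMulTop_of_isSMulRegular hxm hrs.1 hp
    have hxp : x ∉ p := fun h => by
      have := biUnion_associatedPrimes_eq_compl_regular R M
      have h2 : x ∈ ⋃ p ∈ associatedPrimes R M, (p : Set R) := Set.mem_biUnion hp h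
      rw [this] at h2
      exact h2 hrs.1
    have hpp : p.IsPrime := hp.1
    have hreg : IsSMulRegular (R ⧸ p) x := by
      rw [isSMulRegular_quotient_iff_mem_of_smul_mem]
      intro a ha
      exact (hpp.mem_or_mem ha).resolve_left hxp
    have h1 := supportDim_quotSMulTop_succ_eq_supportDim hreg hxm
    have h2 : supportDim R (R ⧸ p') ≤ supportDim R (QuotSMulTop x (R ⧸ p)) := by
      apply supportDim_mono
      rw [support_quotSMulTop, support_eq_zeroLocus, support_eq_zeroLocus,
        Ideal.annihilator_quotient, Ideal.annihilator_quotient]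
      intro q hq
      exact ⟨fun a ha => hq (hle ha), by simpa using hq hxp'⟩
    have h3 := ih hrs.2 (fun r hr => hmem r (by simp [hr])) hp'
    rw [← h1]
    push_cast [List.length_cons]
    gcongr
    exact h3.trans h2

/-- Dividing by a nonzerodivisor in the maximal ideal lowers the depth by at most one. This follows
from the characterization of depth by vanishing of `Ext` groups. -/
theorem exists_isRegular_quotSMulTop {M : Type u} [AddCommGroup M]
    [Module R M] [Module.Finite R M] {n : ℕ} {x : R} (hx : x ∈ maximalIdeal R)
    (hreg : IsSMulRegular M x)
    (h : ∃ rs : List R, rs.length = n + 1 ∧ (∀ r ∈ rs, r ∈ maximalIdeal R) ∧ IsRegular M rs) :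
    ∃ rs : List R, rs.length = n ∧ (∀ r ∈ rs, r ∈ maximalIdeal R) ∧
      IsRegular (QuotSMulTop x M) rs := by
  have hM : Nontrivial M := by
    obtain ⟨rs, -, -, h⟩ := h
    exact h.nontrivial
  have hlt : maximalIdeal R • (⊤ : Submodule R M) < ⊤ :=
    (Submodule.top_ne_ideal_smul_of_le_jacobson_annihilator
      (maximalIdeal_le_jacobson _)).symm.lt_top
  have : Nontrivial (QuotSMulTop x M) := nontrivial_quotSMulTop_of_mem_maximalIdeal M hx
  have hlt' : maximalIdeal R • (⊤ : Submodule R (QuotSMulTop x M)) < ⊤ :=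
    (Submodule.top_ne_ideal_smul_of_le_jacobson_annihilator
      (maximalIdeal_le_jacobson _)).symm.lt_top
  have h1 := ((ModuleCat.exists_isRegular_tfae (maximalIdeal R) (n + 1) (ModuleCat.of R M)
    hlt).out 1 3).2 h
  refine ((ModuleCat.exists_isRegular_tfae (maximalIdeal R) n
    (ModuleCat.of R (QuotSMulTop x M)) hlt').out 1 3).1 fun i hi => ?_
  have zero1 := AddCommGrpCat.isZero_of_iff_subsingleton.mpr (h1 i (by omega))
  have zero2 := AddCommGrpCat.isZero_of_iff_subsingleton.mpr (h1 (i + 1) (by omega))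
  exact AddCommGrpCat.subsingleton_of_isZero <| ShortComplex.Exact.isZero_of_both_zeros
    ((Ext.covariant_sequence_exact₃' _
      (IsSMulRegular.smulShortComplex_shortExact (M := ModuleCat.of R M) hreg)) i (i + 1) rfl)
    (zero1.eq_zero_of_src _) (zero2.eq_zero_of_tgt _)

theorem supportDim_le_supportDim_quotient_ofList_add_length {M : Type u} [AddCommGroup M]
    [Module R M] [Module.Finite R M] {fs : List R} (hfs : ∀ f ∈ fs, f ∈ maximalIdeal R) :
    supportDim R M ≤ supportDim R (M ⧸ Ideal.ofList fs • (⊤ : Submodule R M)) + fs.length := by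
  induction fs generalizing M with
  | nil =>
    rw [Ideal.ofList_nil, Submodule.bot_smul]
    simpa using (supportDim_eq_of_equiv (Submodule.quotEquivOfEqBot ⊥ rfl)).ge
  | cons x fs ih =>
    have h1 := supportDim_le_supportDim_quotSMulTop_succ (M := M) (hfs x (by simp))
    have h2 := ih (M := QuotSMulTop x M) fun f hf => hfs f (by simp [hf])
    rw [supportDim_eq_of_equiv (Submodule.quotOfListConsSMulTopEquivQuotSMulTopInner M x _)]
    refine h1.trans ?_
    push_cast [List.length_cons]
    rw [← add_assoc]
    gcongr

/-- In a module of depth at least `d`, a sequence of `c` elements of the maximal ideal that cuts the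
dimension down to `d - c` is weakly regular. -/
theorem isWeaklyRegular_of_supportDim_add_length_le {M : Type u} [AddCommGroup M]
    [Module R M] [Module.Finite R M] {d : ℕ}
    (hM : ∃ rs : List R, rs.length = d ∧ (∀ r ∈ rs, r ∈ maximalIdeal R) ∧ IsRegular M rs)
    {fs : List R} (hfs : ∀ f ∈ fs, f ∈ maximalIdeal R)
    (hdim : supportDim R (M ⧸ Ideal.ofList fs • (⊤ : Submodule R M)) + fs.length ≤ d) :
    IsWeaklyRegular M fs := by
  induction fs generalizing M d with
  | nil => exact .nil R M
  | cons x fs ih =>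
    have hxm := hfs x (by simp)
    have hfs' : ∀ f ∈ fs, f ∈ maximalIdeal R := fun f hf => hfs f (by simp [hf])
    rw [supportDim_eq_of_equiv (Submodule.quotOfListConsSMulTopEquivQuotSMulTopInner M x _)] at hdim
    push_cast [List.length_cons] at hdim
    rw [← add_assoc] at hdim
    have hdim' := supportDim_le_supportDim_quotient_ofList_add_length (M := QuotSMulTop x M) hfs'
    have hMn : Nontrivial M := by
      obtain ⟨rs, -, -, h⟩ := hM
      exact h.nontrivial
    have hqn : Nontrivial (QuotSMulTop x M) := nontrivial_quotSMulTop_of_mem_maximalIdeal M hxm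
    obtain ⟨e, he⟩ := WithBot.ne_bot_iff_exists.1
      (supportDim_ne_bot_of_nontrivial R (QuotSMulTop x M))
    have hed : ((e : WithBot ℕ∞)) + 1 ≤ d := by
      rw [he]
      refine le_trans ?_ hdim
      gcongr
    have hed' : e + 1 ≤ d := by exact_mod_cast hed
    -- A zero divisor `x` would lie in an associated prime `p` of `M`; then `R ⧸ p`, of dimension at
    -- least the depth of `M`, would be contained in the support of `M ⧸ xM`, of smaller dimension.
    have hreg : IsSMulRegular M x := by
      by_contra hnr
      have h2 : x ∈ ⋃ p ∈ associatedPrimes R M, (p : Set R) := by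
        rw [biUnion_associatedPrimes_eq_compl_regular R M]
        exact hnr
      obtain ⟨p, hp, hxp⟩ := Set.mem_iUnion₂.1 h2
      obtain ⟨rs, hl, hrm, hrr⟩ := hM
      have h3 := length_le_supportDim_of_mem_associatedPrimes hrr hrm hp
      have h4 : supportDim R (R ⧸ p) ≤ supportDim R (QuotSMulTop x M) := by
        apply supportDim_mono
        rw [support_quotSMulTop, support_eq_zeroLocus, Ideal.annihilator_quotient]
        intro q hq
        refine ⟨mem_support_iff_of_finite.2 (le_trans ?_ hq), by simpa using hq hxp⟩
        rw [← Submodule.annihilator_top]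
        exact IsAssociatedPrime.annihilator_le hp
      rw [hl, ← he] at *
      have h5 := h3.trans h4
      have h6 : (d : ℕ∞) ≤ e := by exact_mod_cast h5
      have h7 : (d : ℕ∞) + 1 ≤ d := by
        refine le_trans ?_ hed'
        gcongr
      have h8 : d + 1 ≤ d := by exact_mod_cast h7
      omega
    refine .cons hreg ?_
    have hd : 1 ≤ d := by
      have : (1 : ℕ∞) ≤ d := le_trans (by simp) hed'
      exact_mod_cast this
    obtain ⟨k, rfl⟩ := Nat.exists_eq_add_of_le' hd
    refine ih (exists_isRegular_quotSMulTop hxm hreg hM) hfs' ?_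
    push_cast at hdim
    exact ENat.WithBot.add_le_add_one_right_iff.1 hdim

end Depth

/-! ### Regular sequences of homogeneous polynomials -/

section Graded

variable {k : Type} [Field k] {n : ℕ}

open MvPolynomial IsLocalRing

/-- Elements with nonzero constant coefficient are nonzerodivisors modulo a homogeneous ideal. Hence
a homogeneous ideal is determined by its localization at the origin. -/
theorem mem_of_mul_mem_of_homogeneousComponent_mem {I : Ideal (MvPolynomial (Fin n) k)}
    (hI : ∀ f ∈ I, ∀ j, homogeneousComponent j f ∈ I) {s g : MvPolynomial (Fin n) k}
    (hs : constantCoeff s ≠ 0) (h : s * g ∈ I) : g ∈ I := by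
  have key : ∀ j, homogeneousComponent j g ∈ I := by
    intro j
    induction j using Nat.strong_induction_on with
    | _ j ih =>
      -- Remove the components of degree `< j`; then the component of degree `j` of the product
      -- is that of `g` times the constant coefficient of `s`.
      set g' := g - ∑ i ∈ Finset.range j, homogeneousComponent i g with hg'
      have h1 : s * g' ∈ I := by
        rw [hg', mul_sub]
        exact I.sub_mem h (I.mul_mem_left _ (I.sum_mem fun i hi => ih i (Finset.mem_range.1 hi)))
      have hcoeff (d : Fin n →₀ ℕ) : coeff d g' = if d.degree < j then 0 else coeff d g := by
        rw [hg', coeff_sub, coeff_sum]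
        simp only [coeff_homogeneousComponent]
        rw [Finset.sum_ite_eq]
        split_ifs <;> simp_all
      have h2 : homogeneousComponent j (s * g') =
          C (constantCoeff s) * homogeneousComponent j g := by
        ext d
        rw [coeff_C_mul, coeff_homogeneousComponent, coeff_homogeneousComponent]
        split_ifs with hd
        · rw [coeff_mul, Finset.sum_eq_single ((0 : Fin n →₀ ℕ), d)]
          · rw [hcoeff, if_neg (by simp [hd])]
            rfl
          · rintro ⟨x, y⟩ hxy hne
            rw [Finset.HasAntidiagonal.mem_antidiagonal] at hxy
            dsimp only at hxy ⊢
            have hx : x ≠ 0 := by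
              rintro rfl
              apply hne
              rw [← hxy, zero_add]
            have hx' : x.degree ≠ 0 := by
              rwa [Ne, Finsupp.degree_eq_zero_iff]
            have hdeg : x.degree + y.degree = d.degree := by
              rw [← map_add, hxy]
            rw [hcoeff, if_pos (by omega), mul_zero]
          · intro hh
            exact absurd (by simp) hh
        · simp
      have h3 := hI _ h1 j
      rw [h2] at h3
      have h4 := I.mul_mem_left (C (constantCoeff s)⁻¹) h3
      rwa [← mul_assoc, ← C_mul, inv_mul_cancel₀ hs, C_1, one_mul] at h4
  rw [← sum_homogeneousComponent g]
  exact I.sum_mem fun i _ => key i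

theorem homogeneousComponent_mem_span {S : Set (MvPolynomial (Fin n) k)}
    (hS : ∀ f ∈ S, ∃ d, f.IsHomogeneous d) {f : MvPolynomial (Fin n) k} (hf : f ∈ Ideal.span S)
    (j : ℕ) : homogeneousComponent j f ∈ Ideal.span S := by
  let _ := MvPolynomial.gradedAlgebra (σ := Fin n) (R := k)
  have := Ideal.homogeneous_span (homogeneousSubmodule (Fin n) k) S hS
  exact homogeneousComponent_mem_of_mem this hf j

/-- The variables form a regular sequence. -/
theorem isWeaklyRegular_X : IsWeaklyRegular (MvPolynomial (Fin n) k)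
    (List.ofFn (X : Fin n → MvPolynomial (Fin n) k)) := by
  rw [isWeaklyRegular_iff]
  intro i hi
  rw [isSMulRegular_quotient_iff_mem_of_smul_mem]
  intro p hp
  have hin : i < n := by simpa using hi
  have key : Ideal.ofList ((List.ofFn (X : Fin n → MvPolynomial (Fin n) k)).take i) =
      Ideal.span (X '' {j : Fin n | j.1 < i}) := by
    rw [Ideal.ofList]
    congr 1
    ext p
    simp only [List.mem_take_iff_getElem, List.length_ofFn, List.getElem_ofFn, Set.mem_ofPred_eq,
      Set.mem_image]
    constructor
    · rintro ⟨j, hj, rfl⟩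
      exact ⟨⟨j, by omega⟩, by simp; omega, rfl⟩
    · rintro ⟨j, hj, rfl⟩
      exact ⟨j.1, by omega, rfl⟩
  rw [key, smul_eq_mul, Ideal.mul_top] at hp ⊢
  rw [mem_ideal_span_X_image] at hp ⊢
  intro m hm
  have : m + Finsupp.single ⟨i, hin⟩ 1 ∈ ((List.ofFn X)[i] • p).support := by
    rw [List.getElem_ofFn, smul_eq_mul, mul_comm, MvPolynomial.mem_support_iff, coeff_mul_X]
    exact MvPolynomial.mem_support_iff.1 hm
  obtain ⟨j, hj, hmj⟩ := hp _ this
  refine ⟨j, hj, ?_⟩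
  have hne : (⟨i, hin⟩ : Fin n) ≠ j := by
    rintro rfl
    exact lt_irrefl i hj
  simpa [Finsupp.single_apply, hne] using hmj

instance isPrime_ker_constantCoeff :
    (RingHom.ker (constantCoeff : MvPolynomial (Fin n) k →+* k)).IsPrime :=
  RingHom.ker_isPrime _

variable (k n) in
/-- The local ring of affine `n`-space at the origin. -/
abbrev LocalizationAtZero : Type :=
  Localization.AtPrime (RingHom.ker (constantCoeff : MvPolynomial (Fin n) k →+* k))

theorem algebraMap_mem_maximalIdeal_localizationAtZero {f : MvPolynomial (Fin n) k}
    (hf : constantCoeff f = 0) :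
    algebraMap _ (LocalizationAtZero k n) f ∈ maximalIdeal (LocalizationAtZero k n) :=
  (IsLocalization.AtPrime.to_map_mem_maximal_iff (LocalizationAtZero k n)
    (RingHom.ker (constantCoeff : MvPolynomial (Fin n) k →+* k)) f).2 hf

theorem exists_isRegular_localizationAtZero :
    ∃ rs : List (LocalizationAtZero k n), rs.length = n ∧
      (∀ r ∈ rs, r ∈ maximalIdeal (LocalizationAtZero k n)) ∧
      IsRegular (LocalizationAtZero k n) rs := by
  have hm : ∀ r ∈ (List.ofFn (X : Fin n → MvPolynomial (Fin n) k)).map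
      (algebraMap _ (LocalizationAtZero k n)), r ∈ maximalIdeal (LocalizationAtZero k n) := by
    intro r hr
    obtain ⟨f, hf, rfl⟩ := List.mem_map.1 hr
    obtain ⟨i, rfl⟩ := List.mem_ofFn.1 hf
    exact algebraMap_mem_maximalIdeal_localizationAtZero (by simp)
  refine ⟨_, by simp, hm, ?_⟩
  exact .of_isWeaklyRegular_of_mem_maximalIdeal _ hm
    (isWeaklyRegular_X.of_isLocalization _ (RingHom.ker constantCoeff).primeCompl)

theorem ringKrullDim_localizationAtZero_quotient_le (I : Ideal (MvPolynomial (Fin n) k)) :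
    ringKrullDim (LocalizationAtZero k n ⧸ I.map (algebraMap _ (LocalizationAtZero k n))) ≤
      ringKrullDim (MvPolynomial (Fin n) k ⧸ I) := by
  rw [ringKrullDim_quotient, ringKrullDim_quotient]
  refine Order.krullDim_le_of_strictMono (fun q => ⟨PrimeSpectrum.comap
    (algebraMap (MvPolynomial (Fin n) k) (LocalizationAtZero k n)) q.1, ?_⟩) ?_
  · intro a ha
    exact q.2 (Ideal.mem_map_of_mem _ ha)
  · intro p q hpq
    refine lt_of_le_of_ne (Ideal.comap_mono hpq.le) fun h => hpq.ne ?_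
    exact Subtype.ext (PrimeSpectrum.localization_comap_injective _
      (RingHom.ker (constantCoeff : MvPolynomial (Fin n) k →+* k)).primeCompl
      (congrArg Subtype.val h))

theorem constantCoeff_eq_zero_of_isHomogeneous {f : MvPolynomial (Fin n) k} {d : ℕ} (hd : 1 ≤ d)
    (hf : f.IsHomogeneous d) : constantCoeff f = 0 := by
  by_contra h
  have := hf h
  simp at this
  omega

/-- Krull's height theorem at the origin: `c` polynomials vanishing there cut the dimension down by
at most `c`. -/
theorem le_ringKrullDim_quotient_ofList_add_length {fs : List (MvPolynomial (Fin n) k)}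
    (hfs : ∀ f ∈ fs, constantCoeff f = 0) :
    (n : WithBot ℕ∞) ≤ ringKrullDim (MvPolynomial (Fin n) k ⧸ Ideal.ofList fs) + fs.length := by
  obtain ⟨rs, hl, -, hreg⟩ := exists_isRegular_localizationAtZero (k := k) (n := n)
  have h1 := supportDim_add_length_eq_supportDim_of_isRegular rs hreg
  have hne := hreg.quot_ofList_smul_nontrivial
  have h2 : (n : WithBot ℕ∞) ≤ supportDim (LocalizationAtZero k n) (LocalizationAtZero k n) := by
    rw [← h1, hl]
    obtain ⟨d, hd⟩ := WithBot.ne_bot_iff_exists.1 (supportDim_ne_bot_of_nontrivial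
      (LocalizationAtZero k n)
      (LocalizationAtZero k n ⧸
        Ideal.ofList rs • (⊤ : Submodule (LocalizationAtZero k n) (LocalizationAtZero k n))))
    rw [← hd]
    exact_mod_cast le_add_self
  have h3 := supportDim_le_supportDim_quotient_ofList_add_length (M := LocalizationAtZero k n)
    (fs := fs.map (algebraMap _ (LocalizationAtZero k n))) (by
      intro r hr
      obtain ⟨f, hf, rfl⟩ := List.mem_map.1 hr
      exact algebraMap_mem_maximalIdeal_localizationAtZero (hfs f hf))
  refine h2.trans (h3.trans ?_)
  rw [List.length_map]
  gcongr
  rw [smul_eq_mul, Ideal.mul_top, supportDim_quotient_eq_ringKrullDim, ← Ideal.map_ofList]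
  exact ringKrullDim_localizationAtZero_quotient_le _

/-- Dividing by a weakly regular sequence of length `c` lowers the dimension by at least `c`. -/
theorem supportDim_quotient_ofList_add_length_le {R : Type*} [CommRing R] {M : Type*}
    [AddCommGroup M] [Module R M] [Module.Finite R M] {fs : List R} (h : IsWeaklyRegular M fs) :
    supportDim R (M ⧸ Ideal.ofList fs • (⊤ : Submodule R M)) + fs.length ≤ supportDim R M := by
  induction fs generalizing M with
  | nil =>
    rw [Ideal.ofList_nil, Submodule.bot_smul]
    simpa using (supportDim_eq_of_equiv (Submodule.quotEquivOfEqBot ⊥ rfl)).le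
  | cons x fs ih =>
    rw [isWeaklyRegular_cons_iff] at h
    have h1 := supportDim_quotSMulTop_succ_le_of_notMem_minimalPrimes (M := M) (x := x)
      fun p hp => h.1.notMem_of_mem_minimalPrimes hp
    have h2 := ih h.2
    rw [supportDim_eq_of_equiv (Submodule.quotOfListConsSMulTopEquivQuotSMulTopInner M x _)]
    refine le_trans ?_ h1
    push_cast [List.length_cons]
    rw [← add_assoc]
    gcongr

/-- The Cohen–Macaulay property of the polynomial ring: a sequence of `c` homogeneous polynomials
of positive degree is weakly regular if and only if it cuts out a scheme of codimension `c`. -/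
theorem isWeaklyRegular_iff_ringKrullDim_add_length {fs : List (MvPolynomial (Fin n) k)}
    (hfs : ∀ f ∈ fs, ∃ d, 1 ≤ d ∧ f.IsHomogeneous d) :
    IsWeaklyRegular (MvPolynomial (Fin n) k) fs ↔
      ringKrullDim (MvPolynomial (Fin n) k ⧸ Ideal.ofList fs) + fs.length = n := by
  have hfs0 : ∀ f ∈ fs, constantCoeff f = 0 := by
    intro f hf
    obtain ⟨d, hd, h⟩ := hfs f hf
    exact constantCoeff_eq_zero_of_isHomogeneous hd h
  constructor
  · intro h
    refine le_antisymm ?_ (le_ringKrullDim_quotient_ofList_add_length hfs0)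
    have h1 := supportDim_quotient_ofList_add_length_le h
    rw [smul_eq_mul, Ideal.mul_top, supportDim_quotient_eq_ringKrullDim,
      supportDim_self_eq_ringKrullDim, MvPolynomial.ringKrullDim_of_isNoetherianRing] at h1
    simpa using h1
  · intro h
    -- The statement holds over the local ring at the origin, and descends by homogeneity.
    have hloc : IsWeaklyRegular (LocalizationAtZero k n)
        (fs.map (algebraMap _ (LocalizationAtZero k n))) := by
      refine isWeaklyRegular_of_supportDim_add_length_le exists_isRegular_localizationAtZero ?_
        (le_trans ?_ h.le)
      · intro r hr
        obtain ⟨f, hf, rfl⟩ := List.mem_map.1 hr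
        exact algebraMap_mem_maximalIdeal_localizationAtZero (hfs0 f hf)
      · rw [List.length_map]
        gcongr
        rw [smul_eq_mul, Ideal.mul_top, supportDim_quotient_eq_ringKrullDim, ← Ideal.map_ofList]
        exact ringKrullDim_localizationAtZero_quotient_le _
    rw [isWeaklyRegular_iff] at hloc ⊢
    intro i hi
    have h1 := hloc i (by simpa using hi)
    rw [isSMulRegular_quotient_iff_mem_of_smul_mem] at h1 ⊢
    intro g hg
    have h2 := h1 (algebraMap _ (LocalizationAtZero k n) g)
    simp only [smul_eq_mul, Ideal.mul_top, List.getElem_map, ← map_mul, ← List.map_take,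
      ← Ideal.map_ofList] at h2 hg ⊢
    have h3 := h2 (Ideal.mem_map_of_mem _ hg)
    rw [IsLocalization.algebraMap_mem_map_algebraMap_iff
      (RingHom.ker (constantCoeff : MvPolynomial (Fin n) k →+* k)).primeCompl] at h3
    obtain ⟨s, hs, hsg⟩ := h3
    refine mem_of_mul_mem_of_homogeneousComponent_mem (fun f hf j => ?_) hs hsg
    refine homogeneousComponent_mem_span (fun f hf => ?_) hf j
    obtain ⟨d, -, hd⟩ := hfs f (List.mem_of_mem_take hf)
    exact ⟨d, hd⟩

end Graded

/-! ### Polynomials on a vector space and cones over projective sets -/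

section Coordinates

variable {V : Type*} [AddCommGroup V] [Module ℂ V]

@[simp]
theorem evalAt_ι (v : V) (l : Dual ℂ V) : evalAt v (SymmetricAlgebra.ι ℂ (Dual ℂ V) l) = l v := by
  simp [evalAt]

theorem ι_mem_symPow_one (l : Dual ℂ V) : SymmetricAlgebra.ι ℂ (Dual ℂ V) l ∈ symPow V 1 := by
  rw [symPow, pow_one]
  exact ⟨l, rfl⟩

theorem mul_mem_symPow {a b : ℕ} {f g : PolyRing V} (hf : f ∈ symPow V a) (hg : g ∈ symPow V b) :
    f * g ∈ symPow V (a + b) := by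
  rw [symPow, pow_add]
  exact Submodule.mul_mem_mul hf hg

theorem evalAt_smul {k : ℕ} {f : PolyRing V} (hf : f ∈ symPow V k) (a : ℂ) (v : V) :
    evalAt (a • v) f = a ^ k * evalAt v f := by
  induction k generalizing f with
  | zero =>
    rw [symPow, pow_zero, Submodule.mem_one] at hf
    obtain ⟨r, rfl⟩ := hf
    simp
  | succ k ih =>
    rw [symPow, pow_succ] at hf
    induction hf using Submodule.mul_induction_on' with
    | mem_mul_mem m hm l hl =>
      obtain ⟨l, rfl⟩ := hl
      rw [map_mul, map_mul, ih hm]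
      simp
      ring
    | add x _ y _ hx hy => rw [map_add, map_add, hx, hy, mul_add]

/-- The second-order Taylor expansion of a quadratic form. -/
theorem evalAt_add_of_mem_symPow_two {q : PolyRing V} (hq : q ∈ symPow V 2) (v u : V) :
    evalAt (v + u) q = evalAt v q + evalAt v (dirDeriv u q) + evalAt u q := by
  rw [symPow, pow_two] at hq
  induction hq using Submodule.mul_induction_on' with
  | mem_mul_mem m hm l hl =>
    obtain ⟨l, rfl⟩ := hl
    obtain ⟨m, rfl⟩ := hm
    simp [dirDeriv_ι, Algebra.algebraMap_eq_smul_one]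
    ring
  | add x _ y _ hx hy => simp only [map_add, hx, hy]; ring

variable (V) [FiniteDimensional ℂ V]

/-- The isomorphism of `Sym(V^*)` with the polynomial ring given by the choice of a basis of `V`. -/
def coordEquiv : PolyRing V ≃ₐ[ℂ] MvPolynomial (Fin (finrank ℂ V)) ℂ :=
  SymmetricAlgebra.equivMvPolynomial (finBasis ℂ V).dualBasis

variable {V}

theorem coordEquiv_ι (l : Dual ℂ V) : coordEquiv V (SymmetricAlgebra.ι ℂ (Dual ℂ V) l) =
    ∑ i, l (finBasis ℂ V i) • MvPolynomial.X i := by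
  conv_lhs => rw [← (finBasis ℂ V).sum_dual_apply_smul_coord l]
  rw [map_sum, map_sum]
  refine Finset.sum_congr rfl fun i _ => ?_
  rw [map_smul, map_smul, ← Basis.coe_dualBasis]
  exact congrArg _ (SymmetricAlgebra.equivMvPolynomial_ι_apply _ i)

theorem aeval_coordEquiv (v : V) (f : PolyRing V) :
    MvPolynomial.aeval (fun i => (finBasis ℂ V).repr v i) (coordEquiv V f) = evalAt v f := by
  have : (MvPolynomial.aeval (fun i => (finBasis ℂ V).repr v i)).comp
      (coordEquiv V).toAlgHom = evalAt v := by
    apply SymmetricAlgebra.algHom_ext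
    ext l
    change MvPolynomial.aeval _ (coordEquiv V _) = evalAt v (SymmetricAlgebra.ι ℂ (Dual ℂ V) l)
    rw [coordEquiv_ι, map_sum, evalAt_ι]
    conv_rhs => rw [← (finBasis ℂ V).sum_repr v, map_sum]
    simp [mul_comm]
  exact DFunLike.congr_fun this f

theorem aeval_coordEquiv' (x : Fin (finrank ℂ V) → ℂ) (f : PolyRing V) :
    MvPolynomial.aeval x (coordEquiv V f) = evalAt ((finBasis ℂ V).equivFun.symm x) f := by
  rw [← aeval_coordEquiv]
  congr 2
  ext i
  rw [← Basis.equivFun_apply, LinearEquiv.apply_symm_apply]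

theorem coordEquiv_isHomogeneous {k : ℕ} {f : PolyRing V} (hf : f ∈ symPow V k) :
    (coordEquiv V f).IsHomogeneous k := by
  induction k generalizing f with
  | zero =>
    rw [symPow, pow_zero, Submodule.mem_one] at hf
    obtain ⟨r, rfl⟩ := hf
    rw [AlgEquiv.commutes]
    exact MvPolynomial.isHomogeneous_C _ _
  | succ k ih =>
    rw [symPow, pow_succ] at hf
    induction hf using Submodule.mul_induction_on' with
    | mem_mul_mem m hm l hl =>
      obtain ⟨l, rfl⟩ := hl
      rw [map_mul]
      refine (ih hm).mul ?_
      rw [coordEquiv_ι]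
      refine MvPolynomial.IsHomogeneous.sum _ _ _ fun i _ => ?_
      rw [MvPolynomial.smul_eq_C_mul]
      exact (MvPolynomial.isHomogeneous_X _ i).C_mul _
    | add x _ y _ hx hy =>
      rw [map_add]
      exact hx.add hy

theorem constantCoeff_coordEquiv (f : PolyRing V) :
    MvPolynomial.constantCoeff (coordEquiv V f) = evalAt 0 f := by
  rw [← aeval_coordEquiv, MvPolynomial.constantCoeff_eq, ← MvPolynomial.constantCoeff_eq]
  simp

/-- A polynomial is determined by its values. -/
theorem eq_zero_of_forall_evalAt_eq_zero {f : PolyRing V} (h : ∀ v, evalAt v f = 0) : f = 0 := by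
  rw [← (coordEquiv V).map_eq_zero_iff]
  refine MvPolynomial.funext fun x => ?_
  rw [map_zero, ← h ((finBasis ℂ V).equivFun.symm x), ← aeval_coordEquiv']
  rfl

/-- Hilbert's Nullstellensatz in `Sym(V^*)`. -/
theorem mem_radical_span_of_forall_evalAt {S : Set (PolyRing V)} {f : PolyRing V}
    (h : ∀ v, (∀ q ∈ S, evalAt v q = 0) → evalAt v f = 0) : f ∈ (Ideal.span S).radical := by
  have h1 : coordEquiv V f ∈ ((Ideal.span S).map (coordEquiv V : PolyRing V →+* _)).radical := by
    rw [← MvPolynomial.vanishingIdeal_zeroLocus_eq_radical (K := ℂ)]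
    intro x hx
    rw [aeval_coordEquiv']
    refine h _ fun q hq => ?_
    rw [← aeval_coordEquiv']
    exact hx _ (Ideal.mem_map_of_mem _ (Ideal.subset_span hq))
  obtain ⟨N, hN⟩ := h1
  refine ⟨N, ?_⟩
  rw [← map_pow] at hN
  obtain ⟨g, hg, hge⟩ := (Ideal.mem_map_iff_of_surjective _ (coordEquiv V).surjective).1 hN
  rwa [← (coordEquiv V).injective hge]

theorem mem_map_coordEquiv_iff {I : Ideal (PolyRing V)} {f : PolyRing V} :
    coordEquiv V f ∈ I.map (coordEquiv V : PolyRing V →+* _) ↔ f ∈ I := by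
  refine ⟨fun h => ?_, fun h => Ideal.mem_map_of_mem _ h⟩
  obtain ⟨g, hg, hge⟩ := (Ideal.mem_map_iff_of_surjective _ (coordEquiv V).surjective).1 h
  rwa [← (coordEquiv V).injective hge]

/-- Polynomials that do not vanish at the origin are nonzerodivisors modulo a homogeneous ideal. -/
theorem mem_of_mul_mem_span_of_evalAt_zero_ne_zero {S : Set (PolyRing V)}
    (hS : ∀ f ∈ S, ∃ d, f ∈ symPow V d) {s g : PolyRing V} (hs : evalAt 0 s ≠ 0)
    (h : s * g ∈ Ideal.span S) : g ∈ Ideal.span S := by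
  rw [← mem_map_coordEquiv_iff] at h ⊢
  rw [← constantCoeff_coordEquiv] at hs
  rw [map_mul] at h
  rw [Ideal.map_span] at h ⊢
  refine mem_of_mul_mem_of_homogeneousComponent_mem (fun f hf j => ?_) hs h
  refine homogeneousComponent_mem_span (fun f hf => ?_) hf j
  obtain ⟨f, hf, rfl⟩ := hf
  obtain ⟨d, hd⟩ := hS f hf
  exact ⟨d, coordEquiv_isHomogeneous hd⟩

theorem ringKrullDim_quotient_map_coordEquiv (I : Ideal (PolyRing V)) :
    ringKrullDim (MvPolynomial (Fin (finrank ℂ V)) ℂ ⧸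
      I.map (coordEquiv V : PolyRing V →+* MvPolynomial (Fin (finrank ℂ V)) ℂ)) =
      ringKrullDim (PolyRing V ⧸ I) :=
  (ringKrullDim_eq_of_ringEquiv
    (Ideal.quotientEquiv I _ (coordEquiv V).toRingEquiv rfl)).symm

theorem finrank_le_ringKrullDim_quotient_add_length {fs : List (PolyRing V)}
    (hfs : ∀ f ∈ fs, ∃ d, 1 ≤ d ∧ f ∈ symPow V d) :
    ((finrank ℂ V : ℕ) : WithBot ℕ∞) ≤ ringKrullDim (PolyRing V ⧸ Ideal.ofList fs) + fs.length := by
  rw [← ringKrullDim_quotient_map_coordEquiv, Ideal.map_ofList]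
  have := le_ringKrullDim_quotient_ofList_add_length
    (fs := fs.map (coordEquiv V : PolyRing V →+* MvPolynomial (Fin (finrank ℂ V)) ℂ)) (by
      intro r hr
      obtain ⟨f, hf, rfl⟩ := List.mem_map.1 hr
      obtain ⟨d, hd, h⟩ := hfs f hf
      exact constantCoeff_eq_zero_of_isHomogeneous hd (coordEquiv_isHomogeneous h))
  rwa [List.length_map] at this

theorem isWeaklyRegular_iff_ringKrullDim_quotient_add_length {fs : List (PolyRing V)}
    (hfs : ∀ f ∈ fs, ∃ d, 1 ≤ d ∧ f ∈ symPow V d) :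
    IsWeaklyRegular (PolyRing V) fs ↔
      ringKrullDim (PolyRing V ⧸ Ideal.ofList fs) + fs.length =
        ((finrank ℂ V : ℕ) : WithBot ℕ∞) := by
  have := isWeaklyRegular_iff_ringKrullDim_add_length
    (fs := fs.map (coordEquiv V : PolyRing V →+* MvPolynomial (Fin (finrank ℂ V)) ℂ)) (by
      intro r hr
      obtain ⟨f, hf, rfl⟩ := List.mem_map.1 hr
      obtain ⟨d, hd, h⟩ := hfs f hf
      exact ⟨d, hd, coordEquiv_isHomogeneous h⟩)
  rw [← Ideal.map_ofList, ringKrullDim_quotient_map_coordEquiv, List.length_map] at this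
  rw [← this]
  refine AddEquiv.isWeaklyRegular_congr (e := (coordEquiv V).toAddEquiv) ?_
  rw [List.forall₂_map_right_iff, List.forall₂_same]
  intro r _ x
  exact map_mul (coordEquiv V) r x

end Coordinates

section Cones

variable {V : Type*} [AddCommGroup V] [Module ℂ V]

theorem mem_affineCone_iff_mk_mem {Z : Set (Projectivization ℂ V)} {v : V} (hv : v ≠ 0) :
    v ∈ affineCone Z ↔ Projectivization.mk ℂ v hv ∈ Z := by
  constructor
  · rintro (h | ⟨p, hp, hvp⟩)
    · exact absurd h hv
    · convert hp
      induction p using Projectivization.ind with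
      | h w hw =>
        rw [Projectivization.submodule_mk, Submodule.mem_span_singleton] at hvp
        exact (Projectivization.mk_eq_mk_iff' _ _ _ _ _).2 hvp
  · intro h
    refine Or.inr ⟨_, h, ?_⟩
    rw [Projectivization.submodule_mk]
    exact Submodule.mem_span_singleton_self v

theorem zero_mem_affineCone (Z : Set (Projectivization ℂ V)) : (0 : V) ∈ affineCone Z := Or.inl rfl

theorem smul_mem_affineCone {Z : Set (Projectivization ℂ V)} (a : ℂ) {v : V}
    (h : v ∈ affineCone Z) : a • v ∈ affineCone Z := by
  rcases h with rfl | ⟨p, hp, hv⟩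
  · rw [smul_zero]
    exact zero_mem_affineCone Z
  · exact Or.inr ⟨p, hp, p.submodule.smul_mem a hv⟩

theorem mk_mem_zeroLocus_iff {S : Set (PolyRing V)} {v : V} (hv : v ≠ 0) :
    Projectivization.mk ℂ v hv ∈ zeroLocus S ↔ ∀ f ∈ S, ∀ a : ℂ, evalAt (a • v) f = 0 := by
  simp [zeroLocus, Submodule.mem_span_singleton]

theorem mem_affineCone_zeroLocus_iff {S : Set (PolyRing V)}
    (hS : ∀ f ∈ S, ∃ d, 1 ≤ d ∧ f ∈ symPow V d) {v : V} :
    v ∈ affineCone (zeroLocus S) ↔ ∀ f ∈ S, evalAt v f = 0 := by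
  have key (f : PolyRing V) (hf : f ∈ S) (a : ℂ) (h : evalAt v f = 0) : evalAt (a • v) f = 0 := by
    obtain ⟨d, -, hd⟩ := hS f hf
    rw [evalAt_smul hd, h, mul_zero]
  by_cases hv : v = 0
  · subst hv
    refine iff_of_true (zero_mem_affineCone _) fun f hf => ?_
    obtain ⟨d, hd1, hd⟩ := hS f hf
    have := evalAt_smul hd 0 (0 : V)
    rwa [smul_zero, zero_pow (by omega), zero_mul] at this
  · rw [mem_affineCone_iff_mk_mem hv, mk_mem_zeroLocus_iff hv]
    exact ⟨fun h f hf => by simpa using h f hf 1, fun h f hf a => key f hf a (h f hf)⟩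

variable {V' : Type*} [AddCommGroup V'] [Module ℂ V']

/-- The pullback of polynomials along a linear map. -/
def pullback (g : V →ₗ[ℂ] V') : PolyRing V' →ₐ[ℂ] PolyRing V :=
  SymmetricAlgebra.lift (SymmetricAlgebra.ι ℂ (Dual ℂ V) ∘ₗ g.dualMap)

@[simp]
theorem pullback_ι (g : V →ₗ[ℂ] V') (l : Dual ℂ V') :
    pullback g (SymmetricAlgebra.ι ℂ _ l) = SymmetricAlgebra.ι ℂ _ (l ∘ₗ g) := by
  simp [pullback, LinearMap.dualMap_apply']

theorem evalAt_pullback (g : V →ₗ[ℂ] V') (v : V) (f : PolyRing V') :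
    evalAt v (pullback g f) = evalAt (g v) f := by
  have : (evalAt v).comp (pullback g) = evalAt (g v) := by
    apply SymmetricAlgebra.algHom_ext
    ext l
    simp
  exact DFunLike.congr_fun this f

theorem pullback_mem_symPow (g : V →ₗ[ℂ] V') {k : ℕ} {f : PolyRing V'} (hf : f ∈ symPow V' k) :
    pullback g f ∈ symPow V k := by
  have : (symPow V' k).map (pullback g).toLinearMap ≤ symPow V k := by
    rw [symPow, symPow, Submodule.map_pow]
    refine pow_le_pow_left' ?_ k
    rintro _ ⟨_, ⟨l, rfl⟩, rfl⟩
    exact ⟨l ∘ₗ g, by simp⟩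
  exact this ⟨f, hf, rfl⟩

theorem pullback_pullback {V'' : Type*} [AddCommGroup V''] [Module ℂ V''] (g : V →ₗ[ℂ] V')
    (g' : V' →ₗ[ℂ] V'') (f : PolyRing V'') : pullback g (pullback g' f) = pullback (g' ∘ₗ g) f := by
  have : (pullback g).comp (pullback g') = pullback (g' ∘ₗ g) := by
    apply SymmetricAlgebra.algHom_ext
    ext l
    simp [LinearMap.comp_assoc]
  exact DFunLike.congr_fun this f

theorem pullback_id (f : PolyRing V) : pullback LinearMap.id f = f := by
  have : pullback (LinearMap.id : V →ₗ[ℂ] V) = AlgHom.id ℂ _ := by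
    apply SymmetricAlgebra.algHom_ext
    ext l
    simp
  exact DFunLike.congr_fun this f

/-- The affine cone over the zero locus of an ideal of a projective set is the zero set of that
ideal. -/
theorem mem_affineCone_zariskiClosure_iff {Z : Set (Projectivization ℂ V)} {v : V} :
    v ∈ affineCone (zariskiClosure Z) ↔ ∀ f ∈ vanishingIdeal Z, evalAt v f = 0 := by
  by_cases hv : v = 0
  · subst hv
    exact iff_of_true (zero_mem_affineCone _) fun f hf => hf 0 (zero_mem_affineCone _)
  · rw [mem_affineCone_iff_mk_mem hv, zariskiClosure, mk_mem_zeroLocus_iff hv]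
    refine ⟨fun h f hf => by simpa using h f hf 1, fun h f hf a => ?_⟩
    -- The ideal is stable under the substitution `v ↦ a • v`.
    have h1 : pullback (a • LinearMap.id) f ∈ vanishingIdeal Z := fun u hu => by
      rw [evalAt_pullback]
      exact hf _ (smul_mem_affineCone a hu)
    simpa [evalAt_pullback] using h _ h1

theorem vanishingIdeal_zariskiClosure (Z : Set (Projectivization ℂ V)) :
    vanishingIdeal (zariskiClosure Z) = vanishingIdeal Z := by
  ext f
  constructor
  · intro h v hv
    exact h v (mem_affineCone_zariskiClosure_iff.2 fun f hf => hf v hv)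
  · intro h v hv
    exact mem_affineCone_zariskiClosure_iff.1 hv f h

/-- A linear isomorphism induces an isomorphism of polynomial rings. -/
def pullbackEquiv (e : V ≃ₗ[ℂ] V') : PolyRing V' ≃ₐ[ℂ] PolyRing V :=
  AlgEquiv.ofAlgHom (pullback e.toLinearMap) (pullback e.symm.toLinearMap)
    (AlgHom.ext fun f => by simp [pullback_pullback, pullback_id])
    (AlgHom.ext fun f => by simp [pullback_pullback, pullback_id])

/-- Being a set-theoretic complete intersection is invariant under linear isomorphisms. -/
theorem IsSetTheoreticCompleteIntersection.of_linearEquiv (e : V ≃ₗ[ℂ] V')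
    {Z : Set (Projectivization ℂ V)} {Z' : Set (Projectivization ℂ V')}
    (hZ : ∀ v, v ∈ affineCone Z ↔ e v ∈ affineCone Z') {c : ℕ}
    (h : IsSetTheoreticCompleteIntersection Z' c) : IsSetTheoreticCompleteIntersection Z c := by
  obtain ⟨hdim, g, hg, hgZ⟩ := h
  refine ⟨?_, fun i => pullback e.toLinearMap (g i), fun i => ?_, ?_⟩
  · have hI : vanishingIdeal Z = (vanishingIdeal Z').map
        ((pullbackEquiv e).toRingEquiv : PolyRing V' →+* PolyRing V) := by
      ext f
      obtain ⟨f, rfl⟩ := (pullbackEquiv e).surjective f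
      have h1 : pullbackEquiv e f ∈ (vanishingIdeal Z').map
        ((pullbackEquiv e).toRingEquiv : PolyRing V' →+* PolyRing V) ↔ f ∈ vanishingIdeal Z' := by
        refine ⟨fun h => ?_, fun h => Ideal.mem_map_of_mem _ h⟩
        obtain ⟨g, hg, hge⟩ := (Ideal.mem_map_iff_of_surjective _ (pullbackEquiv e).surjective).1 h
        rwa [← (pullbackEquiv e).injective hge]
      rw [h1]
      have h2 (v : V) : evalAt v (pullbackEquiv e f) = evalAt (e v) f :=
        evalAt_pullback e.toLinearMap v f
      constructor
      · intro hf v hv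
        have := hf (e.symm v) ((hZ _).2 (by simpa using hv))
        rwa [h2, e.apply_symm_apply] at this
      · intro hf v hv
        rw [h2]
        exact hf _ ((hZ v).1 hv)
    unfold HasCodim at hdim ⊢
    rw [e.finrank_eq, ← hdim]
    congr 1
    exact (ringKrullDim_eq_of_ringEquiv
      (Ideal.quotientEquiv _ _ (pullbackEquiv e).toRingEquiv hI)).symm
  · obtain ⟨d, hd, hgi⟩ := hg i
    exact ⟨d, hd, pullback_mem_symPow _ hgi⟩
  · ext p
    induction p using Projectivization.ind with
    | h v hv =>
      have hev : e v ≠ 0 := by simpa using hv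
      rw [← mem_affineCone_iff_mk_mem hv, hZ, mem_affineCone_iff_mk_mem hev, hgZ,
        mk_mem_zeroLocus_iff, mk_mem_zeroLocus_iff]
      simp [evalAt_pullback]

end Cones

/-! ### The quadrics through an Euler-symmetric variety -/

/-- Linear forms on `V`. The instances on `V` are those derived from its group structure, as in
`PolyRing V`; this keeps terms over product spaces in one syntactic form. -/
abbrev LinForm (V : Type*) [AddCommGroup V] [Module ℂ V] : Type _ := Dual ℂ V

/-- Linear maps, with the same convention. -/
abbrev LinMap (V V' : Type*) [AddCommGroup V] [Module ℂ V] [AddCommGroup V'] [Module ℂ V'] :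
    Type _ := V →ₗ[ℂ] V'

/-- A linear form, as an element of `Sym(V^*)`. -/
abbrev lin {V : Type*} [AddCommGroup V] [Module ℂ V] (l : LinForm V) : PolyRing V :=
  SymmetricAlgebra.ι ℂ (Dual ℂ V) l

section Elimination

variable {V U : Type*} [AddCommGroup V] [Module ℂ V] [AddCommGroup U] [Module ℂ U]

theorem mul_sub_pullback_mem {p : LinMap V U} {τ m g : PolyRing U} {I : Ideal (PolyRing V)}
    {t l y : PolyRing V} (ht : pullback p τ = t) (hl : l = pullback p m + y)
    (hy : t * y - pullback p g ∈ I) : t * l - pullback p (τ * m + g) ∈ I := by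
  rw [map_add, map_mul, ht, hl, mul_add, add_sub_add_left_eq_sub]
  exact hy

/-- If modulo `I` every linear form becomes a polynomial pulled back from `U` after multiplication
by `t`, then every polynomial does so after multiplication by a power of `t`. -/
theorem exists_pow_mul_sub_pullback_mem {p : LinMap V U} {τ : PolyRing U} {I : Ideal (PolyRing V)}
    {t : PolyRing V} (ht : pullback p τ = t)
    (hI : ∀ l : LinForm V, ∃ h, t * lin l - pullback p h ∈ I) (f : PolyRing V) :
    ∃ (k : ℕ) (h : PolyRing U), t ^ k * f - pullback p h ∈ I := by
  subst ht
  induction f using SymmetricAlgebra.induction with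
  | algebraMap r =>
    refine ⟨0, algebraMap ℂ (PolyRing U) r, ?_⟩
    rw [pow_zero, one_mul, AlgHom.commutes, sub_self]
    exact I.zero_mem
  | ι l =>
    obtain ⟨h, hl⟩ := hI l
    exact ⟨1, h, by rwa [pow_one]⟩
  | mul a b ha hb =>
    obtain ⟨k, h, hk⟩ := ha
    obtain ⟨k', h', hk'⟩ := hb
    refine ⟨k + k', h * h', ?_⟩
    have key : pullback p τ ^ (k + k') * (a * b) - pullback p (h * h') =
        (pullback p τ ^ k' * b) * (pullback p τ ^ k * a - pullback p h) +
          pullback p h * (pullback p τ ^ k' * b - pullback p h') := by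
      rw [map_mul]
      ring
    rw [key]
    exact Ideal.add_mem _ (Ideal.mul_mem_left _ _ hk) (Ideal.mul_mem_left _ _ hk')
  | add a b ha hb =>
    obtain ⟨k, h, hk⟩ := ha
    obtain ⟨k', h', hk'⟩ := hb
    refine ⟨k + k', τ ^ k' * h + τ ^ k * h', ?_⟩
    have key : pullback p τ ^ (k + k') * (a + b) - pullback p (τ ^ k' * h + τ ^ k * h') =
        pullback p τ ^ k' * (pullback p τ ^ k * a - pullback p h) +
          pullback p τ ^ k * (pullback p τ ^ k' * b - pullback p h') := by
      rw [map_add, map_mul, map_mul, map_pow, map_pow]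
      ring
    rw [key]
    exact Ideal.add_mem _ (Ideal.mul_mem_left _ _ hk) (Ideal.mul_mem_left _ _ hk')

theorem mem_of_pow_mul_mem {R : Type*} [CommRing R] {I : Ideal R} {t : R}
    (ht : ∀ f, t * f ∈ I → f ∈ I) (k : ℕ) : ∀ f, t ^ k * f ∈ I → f ∈ I := by
  induction k with
  | zero => intro f hf; simpa using hf
  | succ k ih =>
    intro f hf
    rw [pow_succ', mul_assoc] at hf
    exact ih f (ht _ hf)

/-- If `t` is a nonzerodivisor modulo `I`, and no nonzero polynomial pulled back from `U` lies in
`I' ⊇ I`, then `I' = I` under the hypothesis of `exists_pow_mul_sub_pullback_mem`. -/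
theorem eq_of_le_of_exists_mul_sub_pullback_mem {p : LinMap V U} {τ : PolyRing U}
    {I I' : Ideal (PolyRing V)} {t : PolyRing V} (ht : pullback p τ = t)
    (hI : ∀ l : LinForm V, ∃ h, t * lin l - pullback p h ∈ I) (hle : I ≤ I')
    (hreg : ∀ f, t * f ∈ I → f ∈ I) (h0 : ∀ h, pullback p h ∈ I' → h = 0) : I' = I := by
  refine le_antisymm (fun f hf => ?_) hle
  obtain ⟨k, h, hk⟩ := exists_pow_mul_sub_pullback_mem ht hI f
  have h1 : pullback p h ∈ I' := by
    have := Ideal.sub_mem _ (Ideal.mul_mem_left _ (t ^ k) hf) (hle hk)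
    rwa [sub_sub_cancel] at this
  rw [h0 h h1, map_zero, sub_zero] at hk
  exact mem_of_pow_mul_mem hreg k f hk

end Elimination

namespace SymbolSystem

variable {W : Type*} [AddCommGroup W] [Module ℂ W] (F : SymbolSystem W 2)

/-- The projection `V_F → ℂ`. -/
def toT : LinForm F.ambient := LinearMap.fst ℂ ℂ (W × Dual ℂ (F.comp 2))

/-- The projection `V_F → W`. -/
def toW : LinMap F.ambient W :=
  LinearMap.fst ℂ W (Dual ℂ (F.comp 2)) ∘ₗ LinearMap.snd ℂ ℂ _

/-- The projection `V_F → (F^2)^*`. -/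
def toY : LinMap F.ambient (Dual ℂ (F.comp 2)) :=
  LinearMap.snd ℂ W (Dual ℂ (F.comp 2)) ∘ₗ LinearMap.snd ℂ ℂ _

/-- The coordinate `t` on `V_F`. -/
def tForm : PolyRing F.ambient := lin F.toT

/-- The coordinate on `(F^2)^*` defined by `q ∈ F^2`, as a linear form on `V_F`. -/
def yForm : F.comp 2 →ₗ[ℂ] PolyRing F.ambient :=
  SymmetricAlgebra.ι ℂ (LinForm F.ambient) ∘ₗ F.toY.dualMap ∘ₗ Dual.eval ℂ (F.comp 2)

/-- The quadratic equation `t y_q - q(w)` of the Euler-symmetric variety. -/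
def quad : F.comp 2 →ₗ[ℂ] PolyRing F.ambient :=
  LinearMap.mulLeft ℂ F.tForm ∘ₗ F.yForm -
    (pullback (F.toW)).toLinearMap ∘ₗ (F.comp 2).subtype

theorem quad_apply (q : F.comp 2) :
    F.quad q = F.tForm * F.yForm q - pullback F.toW (q : PolyRing W) := rfl

@[simp]
theorem evalAt_tForm (v : F.ambient) : evalAt v F.tForm = v.1 := by
  exact evalAt_ι v F.toT

@[simp]
theorem evalAt_yForm (v : F.ambient) (q : F.comp 2) : evalAt v (F.yForm q) = v.2.2 q := by
  exact evalAt_ι v _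

@[simp]
theorem toW_apply (v : F.ambient) : F.toW v = v.2.1 := rfl

theorem evalAt_quad (v : F.ambient) (q : F.comp 2) :
    evalAt v (F.quad q) = v.1 * v.2.2 q - evalAt v.2.1 (q : PolyRing W) := by
  rw [quad_apply, map_sub, map_mul, evalAt_tForm, evalAt_yForm, evalAt_pullback, toW_apply]

theorem tForm_mem_symPow : F.tForm ∈ symPow F.ambient 1 := ι_mem_symPow_one _

theorem quad_mem_symPow (q : F.comp 2) : F.quad q ∈ symPow F.ambient 2 := by
  rw [quad_apply]
  exact Submodule.sub_mem _ (mul_mem_symPow F.tForm_mem_symPow (ι_mem_symPow_one _))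
    (pullback_mem_symPow _ (F.comp_le 2 q.2))

@[simp]
theorem phi_fst (t : ℂ) (w : W) : (F.phi t w).1 = t ^ 2 := rfl

@[simp]
theorem phi_snd_fst (t : ℂ) (w : W) : (F.phi t w).2.1 = t • w := rfl

@[simp]
theorem phi_snd_snd (t : ℂ) (w : W) (q : F.comp 2) :
    (F.phi t w).2.2 q = evalAt w (q : PolyRing W) :=
  rfl

/-- The parametrization of the affine cone is homogeneous of degree two. -/
theorem phi_smul (a t : ℂ) (w : W) : F.phi (a * t) (a • w) = a ^ 2 • F.phi t w := by
  refine Prod.ext ?_ (Prod.ext ?_ ?_)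
  · simp [mul_pow]
  · simp only [phi_snd_fst, Prod.smul_snd, Prod.smul_fst, smul_smul]
    congr 1
    ring
  · ext q
    simp only [phi_snd_snd, Prod.smul_snd, LinearMap.smul_apply, smul_eq_mul]
    exact evalAt_smul (F.comp_le 2 q.2) a w

theorem mem_vanishingIdeal_variety_iff {f : PolyRing F.ambient} :
    f ∈ vanishingIdeal F.variety ↔ ∀ t w, evalAt (F.phi t w) f = 0 := by
  rw [variety, vanishingIdeal_zariskiClosure]
  constructor
  · intro h t w
    refine h _ ?_
    by_cases h0 : F.phi t w = 0
    · exact Or.inl h0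
    · rw [mem_affineCone_iff_mk_mem h0]
      exact ⟨t, w, h0, rfl⟩
  · rintro h v (rfl | ⟨p, ⟨t, w, h0, rfl⟩, hv⟩)
    · have := F.phi_smul 0 0 0
      rw [zero_pow two_ne_zero, zero_smul ℂ (F.phi 0 0)] at this
      rw [← this]
      exact h _ _
    · rw [Projectivization.submodule_mk, Submodule.mem_span_singleton] at hv
      obtain ⟨a, rfl⟩ := hv
      obtain ⟨b, rfl⟩ := IsAlgClosed.exists_pow_nat_eq a two_pos
      rw [← phi_smul]
      exact h _ _

/-- The ideal generated by the quadrics `t y_q - q(w)`. -/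
def quadIdeal : Ideal (PolyRing F.ambient) := Ideal.span (Set.range F.quad)

theorem quadIdeal_le_vanishingIdeal : F.quadIdeal ≤ vanishingIdeal F.variety := by
  rw [quadIdeal, Ideal.span_le]
  rintro _ ⟨q, rfl⟩
  rw [SetLike.mem_coe, mem_vanishingIdeal_variety_iff]
  intro t w
  rw [evalAt_quad, phi_fst, phi_snd_fst, phi_snd_snd, evalAt_smul (F.comp_le 2 q.2), sub_self]

section Parametrization

/-- The projection `ℂ ⊕ W → W`. -/
def baseToW (W : Type*) [AddCommGroup W] [Module ℂ W] : LinMap (ℂ × W) W := LinearMap.snd ℂ ℂ W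

/-- The coordinate `t` on `ℂ ⊕ W`. -/
def baseForm (W : Type*) [AddCommGroup W] [Module ℂ W] : PolyRing (ℂ × W) :=
  lin (LinearMap.fst ℂ ℂ W)

/-- The projection `V_F → ℂ ⊕ W`. -/
def toBase : LinMap F.ambient (ℂ × W) :=
  F.toT.prod F.toW

theorem pullback_toBase_baseForm (F : SymbolSystem W 2) :
    pullback F.toBase (baseForm W) = F.tForm := by
  rw [baseForm, pullback_ι]
  rfl

/-- Substitution of the parametrization `(t, w) ↦ (t^2, t w, ι_w^2)` into polynomials on `V_F`. -/
def paramHom [FiniteDimensional ℂ (F.comp 2)] : PolyRing F.ambient →ₐ[ℂ] PolyRing (ℂ × W) :=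
  SymmetricAlgebra.lift
    (LinearMap.toSpanSingleton ℂ _ (baseForm W ^ 2) ∘ₗ Dual.eval ℂ F.ambient (1, 0, 0) +
      LinearMap.mulLeft ℂ (baseForm W) ∘ₗ SymmetricAlgebra.ι ℂ _ ∘ₗ
        (LinearMap.inr ℂ ℂ _ ∘ₗ LinearMap.inl ℂ W (Dual ℂ (F.comp 2)) ∘ₗ
          LinearMap.snd ℂ ℂ W).dualMap +
      (pullback (baseToW W)).toLinearMap ∘ₗ (F.comp 2).subtype ∘ₗ
        (evalEquiv ℂ (F.comp 2)).symm.toLinearMap ∘ₗ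
        (LinearMap.inr ℂ ℂ _ ∘ₗ LinearMap.inr ℂ W (Dual ℂ (F.comp 2))).dualMap)

theorem apply_ambient (l : LinForm F.ambient) (v : F.ambient) :
    l v = v.1 * l (1, 0, 0) + l (0, v.2.1, 0) + l (0, 0, v.2.2) := by
  obtain ⟨a, b, η⟩ := v
  have : ((a, b, η) : F.ambient) = a • (1, 0, 0) + (0, b, 0) + (0, 0, η) := by
    simp
  rw [this, map_add, map_add, map_smul]
  simp

/-- The element of `F^2` corresponding to the restriction of a linear form on `V_F` to
`(F^2)^*`. -/
def yPart [FiniteDimensional ℂ (F.comp 2)] (l : LinForm F.ambient) : F.comp 2 :=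
  (evalEquiv ℂ (F.comp 2)).symm
    (l ∘ₗ (LinearMap.inr ℂ ℂ _ ∘ₗ LinearMap.inr ℂ W (Dual ℂ (F.comp 2))))

theorem apply_yPart [FiniteDimensional ℂ (F.comp 2)] (l : LinForm F.ambient)
    (η : Dual ℂ (F.comp 2)) : η (F.yPart l) = l (0, 0, η) :=
  apply_evalEquiv_symm_apply _ _ η _

theorem paramHom_ι [FiniteDimensional ℂ (F.comp 2)] (l : LinForm F.ambient) :
    F.paramHom (lin l) = l (1, 0, 0) • baseForm W ^ 2 +
      baseForm W * lin (l ∘ₗ LinearMap.inr ℂ ℂ _ ∘ₗ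
        LinearMap.inl ℂ W (Dual ℂ (F.comp 2)) ∘ₗ LinearMap.snd ℂ ℂ W) +
      pullback (baseToW W) (F.yPart l : PolyRing W) :=
  SymmetricAlgebra.lift_ι_apply _ _

@[simp]
theorem evalAt_baseForm (v : ℂ × W) : evalAt v (baseForm W) = v.1 := by
  simp [baseForm]

theorem evalAt_paramHom_ι [FiniteDimensional ℂ (F.comp 2)] (t : ℂ) (w : W)
    (l : LinForm F.ambient) :
    evalAt ((t, w) : ℂ × W) (F.paramHom (lin l)) = l (F.phi t w) := by
  have h1 : evalAt w (F.yPart l : PolyRing W) = l (0, 0, (F.phi t w).2.2) :=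
    F.apply_yPart l (F.phi t w).2.2
  have h2 : l (0, (F.phi t w).2.1, 0) = t * l (0, w, 0) := by
    rw [← smul_eq_mul, ← map_smul, Prod.smul_mk, Prod.smul_mk, smul_zero, smul_zero]
    rfl
  rw [F.paramHom_ι l, F.apply_ambient l (F.phi t w), h2, ← h1]
  have h3 : evalAt ((t, w) : ℂ × W) (pullback (baseToW W) (F.yPart l : PolyRing W)) =
      evalAt w (F.yPart l : PolyRing W) := evalAt_pullback _ _ _
  have h4 : evalAt ((t, w) : ℂ × W) (lin (l ∘ₗ LinearMap.inr ℂ ℂ _ ∘ₗ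
      LinearMap.inl ℂ W (Dual ℂ (F.comp 2)) ∘ₗ LinearMap.snd ℂ ℂ W)) = l (0, w, 0) := evalAt_ι _ _
  rw [map_add, map_add, map_smul, map_pow, map_mul, evalAt_baseForm, h3, h4, phi_fst, smul_eq_mul,
    mul_comm]

theorem evalAt_paramHom [FiniteDimensional ℂ (F.comp 2)] (t : ℂ) (w : W)
    (f : PolyRing F.ambient) :
    evalAt ((t, w) : ℂ × W) (F.paramHom f) = evalAt (F.phi t w) f := by
  have : (evalAt ((t, w) : ℂ × W)).comp F.paramHom = evalAt (F.phi t w) := by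
    apply SymmetricAlgebra.algHom_ext
    refine LinearMap.ext fun l => ?_
    refine (F.evalAt_paramHom_ι t w l).trans ?_
    exact (evalAt_ι _ _).symm
  exact DFunLike.congr_fun this f

/-- Every linear form on `V_F` is the sum of a linear form on `ℂ ⊕ W` and a coordinate `y_q`. -/
theorem exists_ι_eq [FiniteDimensional ℂ (F.comp 2)] (l : LinForm F.ambient) :
    ∃ (m : LinForm (ℂ × W)) (q : F.comp 2),
    lin l =
      pullback F.toBase (lin m) + F.yForm q := by
  refine ⟨l ∘ₗ (LinearMap.id.prodMap (LinearMap.inl ℂ W (Dual ℂ (F.comp 2)))), F.yPart l, ?_⟩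
  rw [pullback_ι]
  refine Eq.trans (congrArg lin ?_)
    (map_add (SymmetricAlgebra.ι ℂ (LinForm F.ambient)) _ (Dual.eval ℂ (F.comp 2) (F.yPart l) ∘ₗ
      F.toY))
  refine LinearMap.ext fun v => ?_
  obtain ⟨a, b, η⟩ := v
  change l (a, b, η) = l (a, b, 0) + η (F.yPart l)
  rw [apply_yPart, ← map_add l, Prod.mk_add_mk, Prod.mk_add_mk, add_zero, add_zero, zero_add]

theorem tForm_mul_ι_sub_mem [FiniteDimensional ℂ (F.comp 2)] (l : LinForm F.ambient) :
    ∃ h : PolyRing (ℂ × W),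
    F.tForm * lin l - pullback F.toBase h ∈ F.quadIdeal := by
  obtain ⟨m, q, h⟩ := F.exists_ι_eq l
  refine ⟨baseForm W * lin m + pullback (baseToW W) (q : PolyRing W), ?_⟩
  refine mul_sub_pullback_mem F.pullback_toBase_baseForm h ?_
  have h1 := pullback_pullback F.toBase (baseToW W) (q : PolyRing W)
  exact (congrArg (F.tForm * F.yForm q - ·) h1).symm ▸ Ideal.subset_span ⟨q, rfl⟩

variable [FiniteDimensional ℂ W] [FiniteDimensional ℂ (F.comp 2)]

/-- The ideal of the Euler-symmetric variety is the kernel of the substitution of the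
parametrization. -/
theorem mem_vanishingIdeal_variety_iff_paramHom {f : PolyRing F.ambient} :
    f ∈ vanishingIdeal F.variety ↔ F.paramHom f = 0 := by
  rw [mem_vanishingIdeal_variety_iff]
  constructor
  · intro h
    refine eq_zero_of_forall_evalAt_eq_zero fun v => ?_
    obtain ⟨t, w⟩ := v
    rw [evalAt_paramHom, h]
  · intro h t w
    rw [← evalAt_paramHom, h, map_zero]

/-- As `M(F)` is irreducible and not contained in `t = 0`, the form `t` is a nonzerodivisor modulo
its ideal. -/
theorem mem_vanishingIdeal_variety_of_tForm_mul_mem {f : PolyRing F.ambient}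
    (h : F.tForm * f ∈ vanishingIdeal F.variety) : f ∈ vanishingIdeal F.variety := by
  rw [mem_vanishingIdeal_variety_iff_paramHom] at h ⊢
  rw [map_mul] at h
  refine (mul_eq_zero.1 h).resolve_left fun h0 => ?_
  have := F.evalAt_paramHom 1 0 F.tForm
  simp [h0] at this

/-- If `t` is a nonzerodivisor modulo the quadrics, then the quadrics generate the ideal of the
Euler-symmetric variety. -/
theorem vanishingIdeal_variety_eq_quadIdeal_of_tForm_regular
    (ht : ∀ f, F.tForm * f ∈ F.quadIdeal → f ∈ F.quadIdeal) :
    vanishingIdeal F.variety = F.quadIdeal := by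
  refine eq_of_le_of_exists_mul_sub_pullback_mem F.pullback_toBase_baseForm F.tForm_mul_ι_sub_mem
    F.quadIdeal_le_vanishingIdeal ht fun h h0 => ?_
  rw [mem_vanishingIdeal_variety_iff] at h0
  have h1 : baseForm W * h = 0 := by
    refine eq_zero_of_forall_evalAt_eq_zero fun v => ?_
    obtain ⟨s, u⟩ := v
    rw [map_mul, baseForm, evalAt_ι]
    obtain ⟨t, rfl⟩ := IsAlgClosed.exists_pow_nat_eq s two_pos
    by_cases ht0 : t = 0
    · simp [ht0]
    · have := h0 t (t⁻¹ • u)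
      rw [evalAt_pullback] at this
      have h2 : F.toBase (F.phi t (t⁻¹ • u)) = (t ^ 2, u) := by
        refine Prod.ext rfl ?_
        change t • t⁻¹ • u = u
        rw [smul_smul, mul_inv_cancel₀ ht0, one_smul]
      rw [h2] at this
      rw [this, mul_zero]
  refine (mul_eq_zero.1 h1).resolve_left fun h0 => ?_
  have : evalAt ((1, 0) : ℂ × W) (baseForm W) = 1 := by simp [baseForm]
  rw [h0, map_zero] at this
  exact zero_ne_one this

end Parametrization

end SymbolSystem

/-! ### Generators of the ideal of an Euler-symmetric variety -/

section Augmented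

variable {K A : Type*} [Field K] [CommRing A] [Algebra K A]

theorem finrank_map_mkQ {N E : Submodule K A} (h : Disjoint E N) :
    finrank K (E.map N.mkQ) = finrank K E := by
  rw [← LinearMap.range_domRestrict]
  refine LinearMap.finrank_range_of_inj ((injective_iff_map_eq_zero _).2 fun q hq => ?_)
  rw [LinearMap.domRestrict_apply, Submodule.mkQ_apply, Submodule.Quotient.mk_eq_zero] at hq
  exact Subtype.ext (Submodule.disjoint_def.1 h q q.2 hq)

/-- If `I` has `c` generators, and `E ⊆ I` is a space of dimension `c` that is linearly independent
modulo `m I`, where `m` is the kernel of an augmentation, then `E` spans `I` modulo `m I`. -/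
theorem le_span_sup_ker_mul (ε : A →ₐ[K] K) {c : ℕ} {g : Fin c → A} {E : Submodule K A}
    (hc : finrank K E = c) (hEI : ∀ q ∈ E, q ∈ Ideal.span (Set.range g))
    (hdisj : ∀ q ∈ E, q ∈ RingHom.ker ε * Ideal.span (Set.range g) → q = 0) :
    Ideal.span (Set.range g) ≤
      Ideal.span (E : Set A) ⊔ RingHom.ker ε * Ideal.span (Set.range g) := by
  set I := Ideal.span (Set.range g) with hI
  set N : Submodule K A := (RingHom.ker ε * I).restrictScalars K with hN
  have hIA : (I.restrictScalars K).map N.mkQ ≤ Submodule.span K (Set.range (N.mkQ ∘ g)) := by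
    rintro _ ⟨f, hf, rfl⟩
    obtain ⟨a, rfl⟩ := Ideal.mem_span_range_iff_exists_fun.1 hf
    rw [map_sum]
    refine Submodule.sum_mem _ fun i _ => ?_
    have h1 : N.mkQ (a i * g i) = ε (a i) • N.mkQ (g i) := by
      rw [← map_smul, ← sub_eq_zero, ← map_sub, Submodule.mkQ_apply, Submodule.Quotient.mk_eq_zero,
        Algebra.smul_def, ← sub_mul]
      refine Ideal.mul_mem_mul ?_ (Ideal.subset_span ⟨i, rfl⟩)
      rw [RingHom.mem_ker, map_sub, AlgHom.commutes]
      exact sub_self _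
    rw [h1]
    exact Submodule.smul_mem _ _ (Submodule.subset_span ⟨i, rfl⟩)
  have hle : E.map N.mkQ ≤ Submodule.span K (Set.range (N.mkQ ∘ g)) :=
    (Submodule.map_mono (p' := I.restrictScalars K) (fun q hq => hEI q hq)).trans hIA
  have heq : E.map N.mkQ = Submodule.span K (Set.range (N.mkQ ∘ g)) := by
    have := FiniteDimensional.span_of_finite K (Set.finite_range (N.mkQ ∘ g))
    refine Submodule.eq_of_le_of_finrank_le hle ?_
    rw [finrank_map_mkQ (Submodule.disjoint_def.2 hdisj), hc]
    have := finrank_range_le_card (R := K) (N.mkQ ∘ g)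
    rwa [Fintype.card_fin] at this
  intro f hf
  have h1 : N.mkQ f ∈ E.map N.mkQ := heq ▸ hIA ⟨f, hf, rfl⟩
  obtain ⟨q, hq, hqf⟩ := h1
  rw [← sub_eq_zero, ← map_sub, Submodule.mkQ_apply, Submodule.Quotient.mk_eq_zero] at hqf
  rw [← sub_sub_cancel q f]
  exact Submodule.sub_mem _ (Submodule.mem_sup_left (Ideal.subset_span hq))
    (Submodule.mem_sup_right hqf)

end Augmented

section Curves

variable {V : Type*} [AddCommGroup V] [Module ℂ V]

/-- The restriction of polynomials on `V` to the curve `ε ↦ v + ε u + ε² z`. -/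
def curveHom (v u z : V) : PolyRing V →ₐ[ℂ] Polynomial ℂ :=
  SymmetricAlgebra.lift (LinearMap.toSpanSingleton ℂ _ 1 ∘ₗ Dual.eval ℂ V v +
    LinearMap.toSpanSingleton ℂ _ Polynomial.X ∘ₗ Dual.eval ℂ V u +
    LinearMap.toSpanSingleton ℂ _ (Polynomial.X ^ 2) ∘ₗ Dual.eval ℂ V z)

theorem curveHom_ι (v u z : V) (l : LinForm V) : curveHom v u z (lin l) =
    l v • 1 + l u • Polynomial.X + l z • Polynomial.X ^ 2 :=
  SymmetricAlgebra.lift_ι_apply _ _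

theorem eval_curveHom (v u z : V) (a : ℂ) (f : PolyRing V) :
    (curveHom v u z f).eval a = evalAt (v + a • u + a ^ 2 • z) f := by
  have : (Polynomial.aeval a).comp (curveHom v u z) = evalAt (v + a • u + a ^ 2 • z) := by
    apply SymmetricAlgebra.algHom_ext
    refine LinearMap.ext fun l => ?_
    change Polynomial.aeval a (curveHom v u z (lin l)) = evalAt (v + a • u + a ^ 2 • z) (lin l)
    rw [curveHom_ι, evalAt_ι]
    simp [mul_comm]
  exact DFunLike.congr_fun this f

theorem coeff_zero_curveHom (v u z : V) (f : PolyRing V) :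
    (curveHom v u z f).coeff 0 = evalAt v f := by
  rw [Polynomial.coeff_zero_eq_eval_zero, eval_curveHom, zero_smul, zero_pow two_ne_zero, zero_smul,
    add_zero, add_zero]

theorem coeff_one_curveHom (v u z : V) (f : PolyRing V) :
    (curveHom v u z f).coeff 1 = evalAt v (dirDeriv u f) := by
  induction f using SymmetricAlgebra.induction with
  | algebraMap r =>
    rw [AlgHom.commutes, Derivation.map_algebraMap, map_zero]
    exact Polynomial.coeff_C_succ
  | ι l =>
    have := curveHom_ι v u z l
    rw [this, dirDeriv_ι]
    simp [Polynomial.coeff_one, Polynomial.coeff_X_pow]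
  | mul a b ha hb =>
    rw [map_mul, Polynomial.mul_coeff_one, ha, hb, coeff_zero_curveHom, coeff_zero_curveHom,
      Derivation.leibniz]
    simp
    ring
  | add a b ha hb => simp [ha, hb]

/-- A polynomial vanishing along a curve has vanishing derivative along its velocity. -/
theorem evalAt_dirDeriv_eq_zero_of_forall {v u z : V} {f : PolyRing V}
    (h : ∀ a : ℂ, evalAt (v + a • u + a ^ 2 • z) f = 0) : evalAt v (dirDeriv u f) = 0 := by
  have : curveHom v u z f = 0 := Polynomial.funext fun a => by
    rw [eval_curveHom, h, Polynomial.eval_zero]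
  rw [← coeff_one_curveHom v u z, this, Polynomial.coeff_zero]

/-- A polynomial vanishing on a punctured line vanishes on the whole line. -/
theorem evalAt_eq_zero_of_forall_ne_zero {v u : V} {f : PolyRing V}
    (h : ∀ a : ℂ, a ≠ 0 → evalAt (v + a • u) f = 0) : evalAt v f = 0 := by
  have : Polynomial.X * curveHom v u 0 f = 0 := Polynomial.funext fun a => by
    by_cases ha : a = 0
    · simp [ha]
    · rw [Polynomial.eval_mul, eval_curveHom, smul_zero, add_zero, h a ha, mul_zero,
        Polynomial.eval_zero]
  rw [← coeff_zero_curveHom v u 0, (mul_eq_zero.1 this).resolve_left Polynomial.X_ne_zero,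
    Polynomial.coeff_zero]

/-- The linear term of `f` at the origin, as a linear form. -/
def linearTerm (f : PolyRing V) : LinForm V where
  toFun v := evalAt 0 (dirDeriv v f)
  map_add' u v := by simp [dirDeriv_add]
  map_smul' a v := by simp [dirDeriv_smul]

theorem linearTerm_apply (f : PolyRing V) (v : V) :
    linearTerm f v = evalAt 0 (dirDeriv v f) := rfl

theorem curveHom_of_mem_symPow {k : ℕ} {f : PolyRing V} (hf : f ∈ symPow V k) (v : V) :
    curveHom 0 v 0 f = Polynomial.C (evalAt v f) * Polynomial.X ^ k := by
  refine Polynomial.funext fun a => ?_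
  rw [eval_curveHom, zero_add, smul_zero, add_zero, evalAt_smul hf, Polynomial.eval_mul,
    Polynomial.eval_C, Polynomial.eval_pow,
    Polynomial.eval_X, mul_comm]

/-- If the elements of `I` have order at least two at the origin, then a quadratic form in `m I`
is zero, as `m I` consists of polynomials of order at least three. -/
theorem evalAt_eq_zero_of_mem_ker_mul {I : Ideal (PolyRing V)}
    (h0 : ∀ f ∈ I, evalAt 0 f = 0) (h1 : ∀ f ∈ I, linearTerm f = 0) {q : PolyRing V}
    (hq : q ∈ symPow V 2) (hqI : q ∈ RingHom.ker (evalAt (0 : V)) * I) (v : V) :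
    evalAt v q = 0 := by
  have key : Polynomial.X ^ 3 ∣ curveHom 0 v 0 q := by
    clear hq
    refine Submodule.mul_induction_on hqI (fun r hr f hf => ?_) (fun x y hx hy => ?_)
    · rw [map_mul, pow_succ']
      refine mul_dvd_mul ?_ ?_
      · rw [Polynomial.X_dvd_iff, coeff_zero_curveHom]
        exact hr
      · rw [Polynomial.X_pow_dvd_iff]
        intro d hd
        interval_cases d
        · rw [coeff_zero_curveHom, h0 f hf]
        · rw [coeff_one_curveHom, ← linearTerm_apply, h1 f hf, LinearMap.zero_apply]
    · rw [map_add]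
      exact dvd_add hx hy
  rw [curveHom_of_mem_symPow hq, Polynomial.X_pow_dvd_iff] at key
  simpa using key 2 (by norm_num)

/-- Nakayama's lemma for the cone `V`: if `I` has as many generators as a space `E ⊆ I` of
homogeneous polynomials that is linearly independent modulo `m I`, then `E` generates `I`. -/
theorem eq_span_of_finrank_eq [FiniteDimensional ℂ V] {c : ℕ} {g : Fin c → PolyRing V}
    {E : Submodule ℂ (PolyRing V)} {d : ℕ} (hE : E ≤ symPow V d) (hc : finrank ℂ E = c)
    (hEI : ∀ q ∈ E, q ∈ Ideal.span (Set.range g))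
    (hdisj : ∀ q ∈ E, q ∈ RingHom.ker (evalAt (0 : V)) * Ideal.span (Set.range g) → q = 0) :
    Ideal.span (Set.range g) = Ideal.span (E : Set (PolyRing V)) := by
  obtain ⟨r, hr, hrI⟩ := Submodule.exists_sub_one_mem_and_smul_le_of_fg_of_le_sup
    (Submodule.fg_span (Set.finite_range g)) (le_refl _)
    (le_span_sup_ker_mul (evalAt (0 : V)) hc hEI hdisj)
  refine le_antisymm (fun f hf => ?_) (Ideal.span_le.2 hEI)
  refine mem_of_mul_mem_span_of_evalAt_zero_ne_zero (s := r) (fun q hq => ⟨d, hE hq⟩) ?_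
    (hrI (Submodule.smul_mem_pointwise_smul f r _ hf))
  rw [RingHom.mem_ker, map_sub, map_one, sub_eq_zero] at hr
  rw [hr]
  exact one_ne_zero

end Curves

namespace SymbolSystem

variable {W : Type*} [AddCommGroup W] [Module ℂ W] (F : SymbolSystem W 2)
  [FiniteDimensional ℂ W] [FiniteDimensional ℂ (F.comp 2)]

/-- The Euler-symmetric variety is not contained in a hyperplane. -/
theorem eq_zero_of_forall_phi (l : LinForm F.ambient) (h : ∀ t w, l (F.phi t w) = 0) : l = 0 := by
  have h1 : l (1, 0, 0) = 0 := by
    have e : F.phi 1 0 = (1, 0, 0) := by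
      refine Prod.ext (by simp) (Prod.ext (by simp) (LinearMap.ext fun q => ?_))
      rw [phi_snd_snd]
      have := evalAt_smul (F.comp_le 2 q.2) 0 (0 : W)
      simpa using this
    rw [← e, h]
  have h2 (w : W) (t : ℂ) : t * l (0, w, 0) + evalAt w (F.yPart l : PolyRing W) = 0 := by
    have e1 := h t w
    have e2 : l (0, (F.phi t w).2.1, 0) = t * l (0, w, 0) := by
      rw [← smul_eq_mul, ← map_smul, Prod.smul_mk, Prod.smul_mk, smul_zero, smul_zero]
      rfl
    have e3 : l (0, 0, (F.phi t w).2.2) = evalAt w (F.yPart l : PolyRing W) :=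
      (F.apply_yPart l (F.phi t w).2.2).symm
    rw [F.apply_ambient l (F.phi t w), h1, e2, e3, mul_zero, zero_add] at e1
    exact e1
  have h3 (w : W) : evalAt w (F.yPart l : PolyRing W) = 0 := by
    simpa using h2 w 0
  have h4 (w : W) : l (0, w, 0) = 0 := by
    simpa [h3] using h2 w 1
  have h5 : F.yPart l = 0 := Subtype.ext (eq_zero_of_forall_evalAt_eq_zero h3)
  refine LinearMap.ext fun v => ?_
  rw [F.apply_ambient l v, h1, h4, ← F.apply_yPart l, h5, map_zero, mul_zero, add_zero, add_zero]
  rfl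

theorem linearTerm_eq_zero_of_mem_vanishingIdeal {f : PolyRing F.ambient}
    (hf : f ∈ vanishingIdeal F.variety) : linearTerm f = 0 := by
  rw [mem_vanishingIdeal_variety_iff] at hf
  refine F.eq_zero_of_forall_phi _ fun t w => ?_
  refine evalAt_dirDeriv_eq_zero_of_forall (z := 0) fun a => ?_
  obtain ⟨b, rfl⟩ := IsAlgClosed.exists_pow_nat_eq a two_pos
  rw [zero_add, smul_zero ((b ^ 2) ^ 2), add_zero, ← phi_smul, hf]

theorem eq_zero_of_forall_evalAt_quad {q : F.comp 2} (h : ∀ v, evalAt v (F.quad q) = 0) :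
    q = 0 := by
  rw [← Module.forall_dual_apply_eq_zero_iff ℂ]
  intro η
  have h1 := h (1, 0, η)
  have h2 := h (0, 0, 0)
  rw [evalAt_quad] at h1 h2
  simp only [zero_mul, zero_sub, neg_eq_zero] at h2
  rw [h2] at h1
  simpa using h1

theorem quad_injective : Function.Injective F.quad := by
  rw [injective_iff_map_eq_zero]
  intro q hq
  exact F.eq_zero_of_forall_evalAt_quad fun v => by rw [hq, map_zero]

/-- If the ideal of the Euler-symmetric variety has only `dim F^2` generators, it is generated by
the quadrics `t y_q - q(w)`. -/
theorem vanishingIdeal_variety_eq_quadIdeal_of_span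
    {g : Fin (finrank ℂ (F.comp 2)) → PolyRing F.ambient}
    (hg : vanishingIdeal F.variety = Ideal.span (Set.range g)) :
    vanishingIdeal F.variety = F.quadIdeal := by
  refine hg.trans ((eq_span_of_finrank_eq (E := LinearMap.range F.quad) (d := 2) ?_
    (LinearMap.finrank_range_of_inj F.quad_injective) ?_ ?_).trans
    (congrArg Ideal.span (LinearMap.coe_range F.quad)))
  · rintro _ ⟨q, rfl⟩
    exact F.quad_mem_symPow q
  · rintro _ ⟨q, rfl⟩
    exact hg ▸ F.quadIdeal_le_vanishingIdeal (Ideal.subset_span ⟨q, rfl⟩)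
  · rintro _ ⟨q, rfl⟩ hq
    rw [← hg] at hq
    have h := F.eq_zero_of_forall_evalAt_quad (evalAt_eq_zero_of_mem_ker_mul
      (I := vanishingIdeal F.variety) (fun f hf => hf 0 (zero_mem_affineCone _))
      (fun f hf => F.linearTerm_eq_zero_of_mem_vanishingIdeal hf) (F.quad_mem_symPow q) hq)
    rw [h, map_zero]

end SymbolSystem

/-! ### Complete intersections and regular sequences -/

section RegularSequences

variable {R S : Type*} [CommRing R] [CommRing S]

theorem isSMulRegular_quotient_smul_top_iff (I : Ideal R) (r : R) :
    IsSMulRegular (R ⧸ (I • ⊤ : Submodule R R)) r ↔ ∀ a, r * a ∈ I → a ∈ I := by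
  rw [show (I • ⊤ : Submodule R R) = I from Ideal.mul_top I]
  exact isSMulRegular_quotient_iff_mem_of_smul_mem _ _

theorem isWeaklyRegular_append_singleton_iff (rs : List R) (t : R) :
    IsWeaklyRegular R (rs ++ [t]) ↔
      IsWeaklyRegular R rs ∧ ∀ a, t * a ∈ Ideal.ofList rs → a ∈ Ideal.ofList rs := by
  rw [isWeaklyRegular_append_iff, isWeaklyRegular_singleton_iff,
    isSMulRegular_quotient_smul_top_iff]

/-- Regularity descends along a ring homomorphism that has a retraction. -/
theorem isWeaklyRegular_of_map_of_leftInverse (φ : R →+* S) (ψ : S →+* R)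
    (h : ∀ x, ψ (φ x) = x) {rs : List R} (hrs : IsWeaklyRegular S (rs.map φ)) :
    IsWeaklyRegular R rs := by
  rw [isWeaklyRegular_iff] at hrs ⊢
  intro i hi
  have hi' : i < (rs.map φ).length := by rwa [List.length_map]
  have h1 := hrs i hi'
  rw [isSMulRegular_quotient_smul_top_iff] at h1 ⊢
  intro a ha
  have h2 := h1 (φ a) (by
    rw [List.getElem_map, ← map_mul, ← List.map_take, ← Ideal.map_ofList]
    exact Ideal.mem_map_of_mem φ ha)
  rw [← List.map_take] at h2
  have h3 := Ideal.mem_map_of_mem ψ h2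
  rwa [Ideal.map_ofList, List.map_map, h, (funext h : ⇑ψ ∘ ⇑φ = id), List.map_id] at h3

theorem ringKrullDim_quotient_eq_of_le_radical {I J : Ideal R} (h : I ≤ J) (h' : J ≤ I.radical) :
    ringKrullDim (R ⧸ J) = ringKrullDim (R ⧸ I) := by
  have : PrimeSpectrum.zeroLocus (J : Set R) = PrimeSpectrum.zeroLocus I := by
    refine (PrimeSpectrum.zeroLocus_anti_mono h).antisymm ?_
    rw [← PrimeSpectrum.zeroLocus_radical I]
    exact PrimeSpectrum.zeroLocus_anti_mono h'
  rw [ringKrullDim_quotient, ringKrullDim_quotient, this]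

theorem ringKrullDim_le_of_surjective_eval₂Hom [IsNoetherianRing R] {c : ℕ} (φ : R →+* S)
    (y : Fin c → S) (h : Function.Surjective (MvPolynomial.eval₂Hom φ y)) :
    ringKrullDim S ≤ ringKrullDim R + c := by
  refine (ringKrullDim_le_of_surjective _ h).trans_eq ?_
  rw [MvPolynomial.ringKrullDim_of_isNoetherianRing, Nat.card_eq_fintype_card, Fintype.card_fin]

theorem span_range_linearMap_eq_ofList {K A M : Type*} [Field K] [CommRing A] [Algebra K A]
    [AddCommGroup M] [Module K M] {c : ℕ} (b : Basis (Fin c) K M) (T : M →ₗ[K] A) :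
    Ideal.span (Set.range T) = Ideal.ofList (List.ofFn fun i => T (b i)) := by
  refine le_antisymm (Ideal.span_le.2 ?_) (Ideal.span_mono ?_)
  · rintro _ ⟨q, rfl⟩
    rw [← b.sum_repr q, map_sum]
    refine Ideal.sum_mem _ fun i _ => ?_
    rw [map_smul, Algebra.smul_def]
    exact Ideal.mul_mem_left _ _ (Ideal.subset_span (List.mem_ofFn.2 ⟨i, rfl⟩))
  · intro x hx
    obtain ⟨i, rfl⟩ := List.mem_ofFn.1 hx
    exact ⟨b i, rfl⟩

theorem sub_add_mem_of_eq {K A : Type*} [Field K] [CommRing A] [Algebra K A] {I : Ideal A}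
    {a : K} {l t m y z : A} (hl : l = a • t + m + y) (hz : z = y) (ht : t ∈ I) :
    l - (m + z) ∈ I := by
  rw [hl, hz, add_assoc, add_sub_cancel_right, Algebra.smul_def]
  exact Ideal.mul_mem_left _ _ ht

end RegularSequences

section Dimension

variable {V : Type*} [AddCommGroup V] [Module ℂ V] [FiniteDimensional ℂ V]

theorem isNoetherianRing_polyRing : IsNoetherianRing (PolyRing V) :=
  isNoetherianRing_of_ringEquiv _ (coordEquiv V).symm.toRingEquiv

theorem ringKrullDim_quotient_vanishingIdeal_zeroLocus {S : Set (PolyRing V)}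
    (hS : ∀ f ∈ S, ∃ d, 1 ≤ d ∧ f ∈ symPow V d) :
    ringKrullDim (PolyRing V ⧸ vanishingIdeal (zeroLocus S)) =
      ringKrullDim (PolyRing V ⧸ Ideal.span S) := by
  refine ringKrullDim_quotient_eq_of_le_radical (Ideal.span_le.2 fun f hf v hv => ?_)
    fun f hf => mem_radical_span_of_forall_evalAt fun v hv => ?_
  · exact (mem_affineCone_zeroLocus_iff hS).1 hv f hf
  · exact hf v ((mem_affineCone_zeroLocus_iff hS).2 hv)

/-- `c` forms define a set-theoretic complete intersection of codimension `c` if and only if they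
form a regular sequence. -/
theorem isSetTheoreticCompleteIntersection_zeroLocus_iff {c : ℕ} {Q : Fin c → PolyRing V}
    (hQ : ∀ i, ∃ d, 1 ≤ d ∧ Q i ∈ symPow V d) :
    IsSetTheoreticCompleteIntersection (zeroLocus (Set.range Q)) c ↔
      IsWeaklyRegular (PolyRing V) (List.ofFn Q) := by
  have h : Set.range Q = {f | f ∈ List.ofFn Q} := by
    ext f
    exact List.mem_ofFn.symm
  rw [IsSetTheoreticCompleteIntersection, and_iff_left ⟨Q, hQ, rfl⟩, HasCodim,
    isWeaklyRegular_iff_ringKrullDim_quotient_add_length, List.length_ofFn,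
    ringKrullDim_quotient_vanishingIdeal_zeroLocus, h]
  · rintro _ ⟨i, rfl⟩
    exact hQ i
  · intro f hf
    obtain ⟨i, rfl⟩ := List.mem_ofFn.1 hf
    exact hQ i

variable {U : Type*} [AddCommGroup U] [Module ℂ U]

/-- If modulo `K` the ring `Sym(V^*)` is generated by polynomials pulled back from `U` and by `c`
further elements, then this bounds the dimension of the quotient by `K`. -/
theorem ringKrullDim_quotient_le_add {p : LinMap U V} {I : Ideal (PolyRing V)}
    {K : Ideal (PolyRing U)} (hIK : ∀ f ∈ I, pullback p f ∈ K) {c : ℕ} (y : Fin c → PolyRing U)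
    (h : ∀ l : LinForm U, ∃ (m : PolyRing V) (a : Fin c → ℂ),
      lin l - (pullback p m + ∑ i, a i • y i) ∈ K) :
    ringKrullDim (PolyRing U ⧸ K) ≤ ringKrullDim (PolyRing V ⧸ I) + c := by
  have := isNoetherianRing_polyRing (V := V)
  set φ : PolyRing V ⧸ I →+* PolyRing U ⧸ K :=
    Ideal.quotientMap K (pullback p : PolyRing V →+* PolyRing U) hIK with hφ
  refine ringKrullDim_le_of_surjective_eval₂Hom φ (fun i => Ideal.Quotient.mk K (y i)) ?_
  set Ψ := MvPolynomial.eval₂Hom φ (fun i => Ideal.Quotient.mk K (y i))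
  have h1 (m : PolyRing V) : Ideal.Quotient.mk K (pullback p m) ∈ Ψ.rangeS :=
    ⟨MvPolynomial.C (Ideal.Quotient.mk I m), by
      rw [MvPolynomial.coe_eval₂Hom, MvPolynomial.eval₂_C]
      rfl⟩
  have h2 (r : ℂ) : Ideal.Quotient.mk K (algebraMap ℂ _ r) ∈ Ψ.rangeS := by
    have := h1 (algebraMap ℂ _ r)
    rwa [AlgHom.commutes] at this
  suffices ∀ f : PolyRing U, Ideal.Quotient.mk K f ∈ Ψ.rangeS by
    intro x
    obtain ⟨f, rfl⟩ := Ideal.Quotient.mk_surjective x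
    exact this f
  intro f
  induction f using SymmetricAlgebra.induction with
  | algebraMap r => exact h2 r
  | ι l =>
    obtain ⟨m, a, hl⟩ := h l
    rw [Ideal.Quotient.mk_eq_mk_iff_sub_mem _ _ |>.2 hl, map_add, map_sum]
    refine add_mem (h1 m) (sum_mem fun i _ => ?_)
    rw [Algebra.smul_def, map_mul]
    exact mul_mem (h2 _) ⟨MvPolynomial.X i, MvPolynomial.eval₂_X _ _ i⟩
  | mul a b ha hb => rw [map_mul]; exact mul_mem ha hb
  | add a b ha hb => rw [map_add]; exact add_mem ha hb

end Dimension

namespace SymbolSystem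

variable {W : Type*} [AddCommGroup W] [Module ℂ W] (F : SymbolSystem W 2)

/-- The inclusion `W → V_F`. -/
def inW : LinMap W F.ambient :=
  LinearMap.inr ℂ ℂ (W × Dual ℂ (F.comp 2)) ∘ₗ LinearMap.inl ℂ W (Dual ℂ (F.comp 2))

theorem ι_eq [FiniteDimensional ℂ (F.comp 2)] (l : LinForm F.ambient) :
    lin l = l (1, 0, 0) • F.tForm + pullback F.toW (lin (l ∘ₗ F.inW)) + F.yForm (F.yPart l) := by
  have e : l = l (1, 0, 0) • F.toT + l ∘ₗ F.inW ∘ₗ F.toW +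
      Dual.eval ℂ (F.comp 2) (F.yPart l) ∘ₗ F.toY := by
    refine LinearMap.ext fun v => ?_
    refine (F.apply_ambient l v).trans ?_
    rw [← F.apply_yPart l, mul_comm]
    rfl
  have e1 : pullback F.toW (lin (l ∘ₗ F.inW)) = lin (l ∘ₗ F.inW ∘ₗ F.toW) := pullback_ι _ _
  rw [e1]
  refine (congrArg lin e).trans ?_
  exact (map_add (SymmetricAlgebra.ι ℂ (LinForm F.ambient)) _ _).trans
    (congrArg (· + F.yForm (F.yPart l))
      ((map_add (SymmetricAlgebra.ι ℂ (LinForm F.ambient)) _ _).trans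
    (congrArg (· + lin (l ∘ₗ F.inW ∘ₗ F.toW))
      (map_smul (SymmetricAlgebra.ι ℂ (LinForm F.ambient)) _ _))))

variable {c : ℕ} (b : Basis (Fin c) ℂ (F.comp 2))

/-- The quadrics `q(w)` on `V_F`, for `q` in a basis of `F^2`. -/
def pulledBackQuadrics : List (PolyRing F.ambient) :=
  (List.ofFn fun i => (b i : PolyRing W)).map (pullback F.toW : PolyRing W →+* PolyRing F.ambient)

/-- The equations `t y_q - q(w)` of the Euler-symmetric variety, for `q` in a basis of `F^2`. -/
def equations : List (PolyRing F.ambient) := List.ofFn fun i => F.quad (b i)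

theorem quadIdeal_eq_ofList : F.quadIdeal = Ideal.ofList (F.equations b) :=
  span_range_linearMap_eq_ofList b F.quad

theorem length_equations : (F.equations b).length = c := List.length_ofFn

theorem length_pulledBackQuadrics : (F.pulledBackQuadrics b).length = c := by
  rw [pulledBackQuadrics, List.length_map, List.length_ofFn]

theorem mem_equations {f : PolyRing F.ambient} : f ∈ F.equations b ↔ ∃ i, F.quad (b i) = f :=
  List.mem_ofFn

theorem mem_pulledBackQuadrics {f : PolyRing F.ambient} :
    f ∈ F.pulledBackQuadrics b ↔ ∃ i, pullback F.toW (b i : PolyRing W) = f := by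
  rw [pulledBackQuadrics, List.mem_map]
  constructor
  · rintro ⟨x, hx, rfl⟩
    obtain ⟨i, rfl⟩ := List.mem_ofFn.1 hx
    exact ⟨i, rfl⟩
  · rintro ⟨i, rfl⟩
    exact ⟨_, List.mem_ofFn.2 ⟨i, rfl⟩, rfl⟩

/-- Modulo `t` the equation `t y_q - q(w)` becomes `-q(w)`. -/
theorem ofList_equations_append :
    Ideal.ofList (F.equations b ++ [F.tForm]) =
      Ideal.ofList (F.pulledBackQuadrics b ++ [F.tForm]) := by
  have ht (L : List (PolyRing F.ambient)) : F.tForm ∈ Ideal.ofList (L ++ [F.tForm]) :=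
    Ideal.subset_span (by simp)
  have hsub {L : List (PolyRing F.ambient)} {f} (hf : f ∈ L) : f ∈ Ideal.ofList (L ++ [F.tForm]) :=
    Ideal.subset_span (by simp [hf])
  refine le_antisymm (Ideal.span_le.2 fun f hf => ?_) (Ideal.span_le.2 fun f hf => ?_)
  · rcases List.mem_append.1 hf with hf | hf
    · obtain ⟨i, rfl⟩ := (F.mem_equations b).1 hf
      rw [quad_apply]
      exact Ideal.sub_mem _ (Ideal.mul_mem_right _ _ (ht _))
        (hsub ((F.mem_pulledBackQuadrics b).2 ⟨i, rfl⟩))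
    · rw [List.mem_singleton.1 hf]
      exact ht _
  · rcases List.mem_append.1 hf with hf | hf
    · obtain ⟨i, rfl⟩ := (F.mem_pulledBackQuadrics b).1 hf
      have : pullback F.toW (b i : PolyRing W) = F.tForm * F.yForm (b i) - F.quad (b i) := by
        rw [quad_apply, sub_sub_cancel]
      rw [this]
      exact Ideal.sub_mem _ (Ideal.mul_mem_right _ _ (ht _))
        (hsub ((F.mem_equations b).2 ⟨i, rfl⟩))
    · rw [List.mem_singleton.1 hf]
      exact ht _

theorem exists_mem_symPow_of_mem_equations {f : PolyRing F.ambient} (hf : f ∈ F.equations b) :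
    ∃ d, 1 ≤ d ∧ f ∈ symPow F.ambient d := by
  obtain ⟨i, rfl⟩ := (F.mem_equations b).1 hf
  exact ⟨2, one_le_two, F.quad_mem_symPow _⟩

theorem exists_mem_symPow_of_mem_equations_append {f : PolyRing F.ambient}
    (hf : f ∈ F.equations b ++ [F.tForm]) : ∃ d, 1 ≤ d ∧ f ∈ symPow F.ambient d := by
  rcases List.mem_append.1 hf with hf | hf
  · exact F.exists_mem_symPow_of_mem_equations b hf
  · rw [List.mem_singleton.1 hf]
    exact ⟨1, le_rfl, F.tForm_mem_symPow⟩

theorem exists_mem_symPow_of_mem_pulledBackQuadrics_append {f : PolyRing F.ambient}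
    (hf : f ∈ F.pulledBackQuadrics b ++ [F.tForm]) : ∃ d, 1 ≤ d ∧ f ∈ symPow F.ambient d := by
  rcases List.mem_append.1 hf with hf | hf
  · obtain ⟨i, rfl⟩ := (F.mem_pulledBackQuadrics b).1 hf
    exact ⟨2, one_le_two, pullback_mem_symPow _ (F.comp_le 2 (b i).2)⟩
  · rw [List.mem_singleton.1 hf]
    exact ⟨1, le_rfl, F.tForm_mem_symPow⟩

variable [FiniteDimensional ℂ W] [FiniteDimensional ℂ (F.comp 2)]

/-- By the dimension criterion for regularity, the order and the choice of generators of the ideal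
`(t, q(w))` do not matter. -/
theorem isWeaklyRegular_equations_append_iff :
    IsWeaklyRegular (PolyRing F.ambient) (F.equations b ++ [F.tForm]) ↔
      IsWeaklyRegular (PolyRing F.ambient) (F.pulledBackQuadrics b ++ [F.tForm]) := by
  rw [isWeaklyRegular_iff_ringKrullDim_quotient_add_length
      (fun f hf => F.exists_mem_symPow_of_mem_equations_append b hf),
    isWeaklyRegular_iff_ringKrullDim_quotient_add_length
      (fun f hf => F.exists_mem_symPow_of_mem_pulledBackQuadrics_append b hf),
    ofList_equations_append, List.length_append, List.length_append, length_equations,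
    length_pulledBackQuadrics]

theorem finrank_ambient : finrank ℂ F.ambient = 1 + (finrank ℂ W + finrank ℂ (F.comp 2)) := by
  rw [finrank_prod, finrank_prod, finrank_self, Subspace.dual_finrank_eq]

theorem isWeaklyRegular_equations_append
    (h : IsWeaklyRegular (PolyRing W) (List.ofFn fun i => (b i : PolyRing W))) :
    IsWeaklyRegular (PolyRing F.ambient) (F.equations b ++ [F.tForm]) := by
  have hb (f) (hf : f ∈ List.ofFn fun i => (b i : PolyRing W)) : ∃ d, 1 ≤ d ∧ f ∈ symPow W d := by
    obtain ⟨i, rfl⟩ := List.mem_ofFn.1 hf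
    exact ⟨2, one_le_two, F.comp_le 2 (b i).2⟩
  rw [isWeaklyRegular_iff_ringKrullDim_quotient_add_length hb, List.length_ofFn] at h
  rw [isWeaklyRegular_iff_ringKrullDim_quotient_add_length
    (fun f hf => F.exists_mem_symPow_of_mem_equations_append b hf)]
  refine le_antisymm ?_ (finrank_le_ringKrullDim_quotient_add_length
    (fun f hf => F.exists_mem_symPow_of_mem_equations_append b hf))
  have key : ringKrullDim (PolyRing F.ambient ⧸ Ideal.ofList (F.equations b ++ [F.tForm])) ≤
      ringKrullDim (PolyRing W ⧸ Ideal.ofList (List.ofFn fun i => (b i : PolyRing W))) + c := by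
    rw [ofList_equations_append]
    refine ringKrullDim_quotient_le_add (p := F.toW) (fun f hf => ?_) (fun i => F.yForm (b i))
      fun l => ⟨lin (l ∘ₗ F.inW), fun i => b.repr (F.yPart l) i, ?_⟩
    · have := Ideal.mem_map_of_mem (pullback F.toW : PolyRing W →+* PolyRing F.ambient) hf
      rw [Ideal.map_ofList] at this
      rw [Ideal.ofList_append]
      exact Ideal.mem_sup_left this
    · have e : ∑ i, b.repr (F.yPart l) i • F.yForm (b i) = F.yForm (F.yPart l) := by
        conv_rhs => rw [← b.sum_repr (F.yPart l), map_sum]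
        exact Finset.sum_congr rfl fun i _ => (map_smul F.yForm _ _).symm
      refine sub_add_mem_of_eq (F.ι_eq l) e (a := l (1, 0, 0)) ?_
      exact Ideal.subset_span (by simp)
  refine (add_le_add_left key _).trans ?_
  rw [h, finrank_ambient, finrank_eq_card_basis b, Fintype.card_fin, List.length_append,
    length_equations, List.length_singleton]
  norm_cast
  omega

/-- The quadrics in `F^2` form a regular sequence if `t` is a nonzerodivisor modulo the regular
sequence of equations `t y_q - q(w)`. -/
theorem isWeaklyRegular_of_equations_append
    (h : IsWeaklyRegular (PolyRing F.ambient) (F.equations b ++ [F.tForm])) :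
    IsWeaklyRegular (PolyRing W) (List.ofFn fun i => (b i : PolyRing W)) := by
  rw [isWeaklyRegular_equations_append_iff, isWeaklyRegular_append_singleton_iff] at h
  refine isWeaklyRegular_of_map_of_leftInverse (pullback F.toW : PolyRing W →+* PolyRing F.ambient)
    (pullback F.inW : PolyRing F.ambient →+* PolyRing W) (fun f => ?_) h.1
  exact (pullback_pullback F.inW F.toW f).trans (pullback_id f)

/-- The Euler-symmetric variety is a complete intersection if and only if a basis of `F^2` is a
regular sequence. -/
theorem isCompleteIntersection_variety_iff : IsCompleteIntersection F.variety c ↔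
    IsWeaklyRegular (PolyRing W) (List.ofFn fun i => (b i : PolyRing W)) := by
  have hc : finrank ℂ (F.comp 2) = c := by rw [finrank_eq_card_basis b, Fintype.card_fin]
  constructor
  · rintro ⟨hdim, g, hg⟩
    refine F.isWeaklyRegular_of_equations_append b ?_
    have hI : vanishingIdeal F.variety = F.quadIdeal := by
      subst hc
      exact F.vanishingIdeal_variety_eq_quadIdeal_of_span hg
    rw [isWeaklyRegular_append_singleton_iff,
      isWeaklyRegular_iff_ringKrullDim_quotient_add_length
      (fun f hf => F.exists_mem_symPow_of_mem_equations b hf), ← quadIdeal_eq_ofList, ← hI,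
      length_equations]
    exact ⟨hdim, fun f hf => F.mem_vanishingIdeal_variety_of_tForm_mul_mem hf⟩
  · intro h
    have h1 := F.isWeaklyRegular_equations_append b h
    rw [isWeaklyRegular_append_singleton_iff] at h1
    obtain ⟨h1, h2⟩ := h1
    rw [← quadIdeal_eq_ofList] at h2
    have hI := F.vanishingIdeal_variety_eq_quadIdeal_of_tForm_regular h2
    refine ⟨?_, fun i => F.quad (b i), ?_⟩
    · rw [isWeaklyRegular_iff_ringKrullDim_quotient_add_length
        (fun f hf => F.exists_mem_symPow_of_mem_equations b hf), ← quadIdeal_eq_ofList, ← hI,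
        length_equations] at h1
      exact h1
    · exact hI.trans ((F.quadIdeal_eq_ofList b).trans
        (congrArg Ideal.span (Set.ext fun f => F.mem_equations b)))

end SymbolSystem

/-! ### Tangent spaces of an Euler-symmetric variety -/

namespace SymbolSystem

variable {W : Type*} [AddCommGroup W] [Module ℂ W] (F : SymbolSystem W 2)

theorem mem_affineCone_variety_iff {v : F.ambient} :
    v ∈ affineCone F.variety ↔ ∀ f ∈ vanishingIdeal F.variety, evalAt v f = 0 := by
  rw [variety, mem_affineCone_zariskiClosure_iff, vanishingIdeal_zariskiClosure]

theorem phi_mem_affineCone_variety (t : ℂ) (w : W) : F.phi t w ∈ affineCone F.variety :=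
  F.mem_affineCone_variety_iff.2 fun _ hf => F.mem_vanishingIdeal_variety_iff.1 hf t w

theorem evalAt_quad_of_mem_affineCone_variety {v : F.ambient} (hv : v ∈ affineCone F.variety)
    (q : F.comp 2) : v.1 * v.2.2 q = evalAt v.2.1 (q : PolyRing W) := by
  have := F.mem_affineCone_variety_iff.1 hv _
    (F.quadIdeal_le_vanishingIdeal (Ideal.subset_span ⟨q, rfl⟩))
  rwa [evalAt_quad, sub_eq_zero] at this

theorem phi_one_ne_zero (w : W) : F.phi 1 w ≠ 0 := fun h => by
  have := congrArg Prod.fst h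
  simp at this

/-- The point `[1 : w : ι_w^2]` of the Euler-symmetric variety. -/
def point (w : W) : Projectivization ℂ F.ambient :=
  Projectivization.mk ℂ (F.phi 1 w) (F.phi_one_ne_zero w)

theorem mem_submodule_point_iff {w : W} {v : F.ambient} :
    v ∈ (F.point w).submodule ↔ ∃ a : ℂ, a • F.phi 1 w = v := by
  rw [point, Projectivization.submodule_mk, Submodule.mem_span_singleton]

/-- Outside the hyperplane `t = 0` the Euler-symmetric variety is the graph of `w ↦ ι_w^2`. -/
theorem exists_eq_smul_phi_one {v : F.ambient} (hv : v ∈ affineCone F.variety) (ht : v.1 ≠ 0) :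
    v = v.1 • F.phi 1 (v.1⁻¹ • v.2.1) := by
  refine Prod.ext ?_ (Prod.ext ?_ (LinearMap.ext fun q => ?_))
  · simp
  · simp [smul_smul, ht]
  · have h := F.evalAt_quad_of_mem_affineCone_variety hv q
    rw [Prod.smul_snd, Prod.smul_snd, LinearMap.smul_apply, phi_snd_snd,
      evalAt_smul (F.comp_le 2 q.2), ← h, smul_eq_mul]
    field_simp

/-- The velocity at `ε = 0` of the curve `ε ↦ (1, w + ε b, ι_{w + ε b}^2)`, as a linear function
of `b`. -/
def velocity (w : W) : LinMap W F.ambient :=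
  LinearMap.prod 0 (LinearMap.prod LinearMap.id
    (LinearMap.mk₂ ℂ (fun (b : W) (q : F.comp 2) => evalAt w (dirDeriv b (q : PolyRing W)))
      (by simp [dirDeriv_add]) (by simp [dirDeriv_smul]) (by simp) (by simp)))

@[simp]
theorem velocity_fst (w b : W) : (F.velocity w b).1 = 0 := rfl

@[simp]
theorem velocity_snd_fst (w b : W) : (F.velocity w b).2.1 = b := rfl

@[simp]
theorem velocity_snd_snd (w b : W) (q : F.comp 2) :
    (F.velocity w b).2.2 q = evalAt w (dirDeriv b (q : PolyRing W)) := rfl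

theorem phi_one_add (w b : W) : F.phi 1 (w + b) = F.phi 1 w + F.velocity w b +
    (0, 0, (evalAt b).toLinearMap.domRestrict (F.comp 2)) := by
  refine Prod.ext ?_ (Prod.ext ?_ (LinearMap.ext fun q => ?_))
  · simp
  · simp
  · exact evalAt_add_of_mem_symPow_two (F.comp_le 2 q.2) w b

theorem domRestrict_evalAt_smul (a : ℂ) (b : W) :
    (evalAt (a • b)).toLinearMap.domRestrict (F.comp 2) =
      a ^ 2 • (evalAt b).toLinearMap.domRestrict (F.comp 2) :=
  LinearMap.ext fun q => evalAt_smul (F.comp_le 2 q.2) a b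

/-- The embedded tangent space at `[1 : w : ι_w^2]` is contained in the span of the point and the
velocities, as the differentials of the quadrics `t y_q - q(w)` show. -/
theorem eq_add_velocity_of_mem_embeddedTangentSpace {w : W} {u : F.ambient}
    (hu : u ∈ embeddedTangentSpace F.variety
      (F.point w)) :
    u = u.1 • F.phi 1 w + F.velocity w (u.2.1 - u.1 • w) := by
  refine Prod.ext ?_ (Prod.ext ?_ (LinearMap.ext fun q => ?_))
  · simp
  · simp
  · have h := hu _ (F.quadIdeal_le_vanishingIdeal (Ideal.subset_span ⟨q, rfl⟩)) (F.phi 1 w)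
      (F.mem_submodule_point_iff.2 ⟨1, one_smul ℂ (F.phi 1 w)⟩)
    have h1 := evalAt_add_of_mem_symPow_two (F.quad_mem_symPow q) (F.phi 1 w) u
    have e1 := F.evalAt_quad (F.phi 1 w + u) q
    have e2 := F.evalAt_quad (F.phi 1 w) q
    have e3 := F.evalAt_quad u q
    have h2 := evalAt_add_of_mem_symPow_two (F.comp_le 2 q.2) w u.2.1
    -- Euler's relation for the quadratic form `q`
    have h3 := evalAt_add_of_mem_symPow_two (F.comp_le 2 q.2) w w
    have h4 := evalAt_smul (F.comp_le 2 q.2) 2 w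
    rw [two_smul, h3] at h4
    simp only [Prod.fst_add, Prod.snd_add, phi_fst, phi_snd_fst, LinearMap.add_apply, phi_snd_snd,
      one_pow, one_smul, h2] at e1 e2
    simp only [Prod.snd_add, Prod.smul_snd, LinearMap.add_apply, LinearMap.smul_apply,
      phi_snd_snd, velocity_snd_snd, smul_eq_mul, sub_eq_add_neg, ← neg_smul, map_add, map_smul]
    linear_combination h1 + h - e1 + e2 + e3 + u.1 * h4

variable [FiniteDimensional ℂ W] [FiniteDimensional ℂ (F.comp 2)]

theorem velocity_mem_embeddedTangentSpace (w b : W) : F.velocity w b ∈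
    embeddedTangentSpace F.variety (F.point w) := by
  intro f hf v hv
  obtain ⟨a, rfl⟩ := F.mem_submodule_point_iff.1 hv
  by_cases ha : a = 0
  · rw [ha, zero_smul ℂ (F.phi 1 w), ← linearTerm_apply,
      F.linearTerm_eq_zero_of_mem_vanishingIdeal hf, LinearMap.zero_apply]
  -- `a φ(1, w + (ε / a) b)` is a curve in the cone with velocity `F.velocity w b`.
  refine evalAt_dirDeriv_eq_zero_of_forall
    (z := a⁻¹ • (0, 0, (evalAt b).toLinearMap.domRestrict (F.comp 2))) fun ε => ?_
  have h : a • F.phi 1 w + ε • F.velocity w b +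
      ε ^ 2 • a⁻¹ • ((0, 0, (evalAt b).toLinearMap.domRestrict (F.comp 2)) : F.ambient) =
      a • F.phi 1 (w + (ε * a⁻¹) • b) := by
    rw [phi_one_add, domRestrict_evalAt_smul, map_smul]
    refine Prod.ext ?_ (Prod.ext ?_ (LinearMap.ext fun q => ?_))
    · simp
    · simp [smul_smul, mul_left_comm a, ha]
    · simp
      field_simp
  rw [h]
  exact F.mem_affineCone_variety_iff.1
    (smul_mem_affineCone _ (F.phi_mem_affineCone_variety 1 _)) f hf

end SymbolSystem

/-! ### Lines through a general point -/

namespace SymbolSystem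

variable {W : Type*} [AddCommGroup W] [Module ℂ W] (F : SymbolSystem W 2)

/-- If all quadrics in `F^2` vanish at `b`, the plane spanned by `φ(1, w)` and the velocity in the
direction `b` is contained in the cone over the Euler-symmetric variety. -/
theorem smul_phi_one_add_smul_velocity_mem {w b : W} (hb : ∀ q ∈ F.comp 2, evalAt b q = 0)
    (α β : ℂ) : α • F.phi 1 w + β • F.velocity w b ∈ affineCone F.variety := by
  have key (α : ℂ) (hα : α ≠ 0) (β : ℂ) :
      α • F.phi 1 w + β • F.velocity w b ∈ affineCone F.variety := by
    have h : α • F.phi 1 w + β • F.velocity w b = α • F.phi 1 (w + (β * α⁻¹) • b) := by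
      have h0 : (evalAt b).toLinearMap.domRestrict (F.comp 2) = 0 :=
        LinearMap.ext fun q => hb q q.2
      rw [phi_one_add, domRestrict_evalAt_smul, map_smul, h0, smul_zero]
      refine Prod.ext ?_ (Prod.ext ?_ (LinearMap.ext fun q => ?_))
      · simp
      · simp [smul_smul, mul_left_comm α, hα]
      · simp
        field_simp
    rw [h]
    exact smul_mem_affineCone _ (F.phi_mem_affineCone_variety 1 _)
  -- The points with `α = 0` are limits of the others.
  by_cases hα : α = 0
  · rw [hα, zero_smul ℂ (F.phi 1 w), zero_add, mem_affineCone_variety_iff]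
    intro f hf
    refine evalAt_eq_zero_of_forall_ne_zero (u := F.phi 1 w) fun a ha => ?_
    rw [add_comm]
    exact F.mem_affineCone_variety_iff.1 (key a ha β) f hf
  · exact key α hα β

/-- Conversely, if `φ(1, w)` plus the velocity in the direction `b` is in the cone over the
Euler-symmetric variety, then all quadrics in `F^2` vanish at `b`. -/
theorem evalAt_eq_zero_of_phi_one_add_velocity_mem {w b : W}
    (h : F.phi 1 w + F.velocity w b ∈ affineCone F.variety) {q : PolyRing W} (hq : q ∈ F.comp 2) :
    evalAt b q = 0 := by
  have h1 := F.evalAt_quad_of_mem_affineCone_variety h ⟨q, hq⟩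
  have h2 := evalAt_add_of_mem_symPow_two (F.comp_le 2 hq) w b
  simp only [Prod.fst_add, Prod.snd_add, phi_fst, phi_snd_fst, velocity_fst, velocity_snd_fst,
    LinearMap.add_apply, phi_snd_snd, velocity_snd_snd, one_pow, one_smul, h2, add_zero,
    one_mul] at h1
  linear_combination -h1

theorem eq_zero_of_velocity_mem_submodule_point {w b : W}
    (h : F.velocity w b ∈ (F.point w).submodule) : b = 0 := by
  obtain ⟨a, ha⟩ := F.mem_submodule_point_iff.1 h
  have h1 := congrArg Prod.fst ha
  have h2 := congrArg (fun v : F.ambient => v.2.1) ha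
  simp at h1 h2
  rw [← h2, h1, zero_smul]

theorem exists_eq_point {x : Projectivization ℂ F.ambient} (hx : x ∈ F.variety)
    (ht : x ∉ zeroLocus {F.tForm}) : ∃ w, x = F.point w := by
  induction x using Projectivization.ind with
  | h v hv =>
    have hv1 : v.1 ≠ 0 := fun h => ht <| by
      rw [mk_mem_zeroLocus_iff]
      rintro _ rfl a
      rw [evalAt_tForm, Prod.smul_fst, h, smul_zero]
    refine ⟨v.1⁻¹ • v.2.1, ?_⟩
    rw [point, Projectivization.mk_eq_mk_iff']
    exact ⟨v.1, (F.exists_eq_smul_phi_one ((mem_affineCone_iff_mk_mem hv).2 hx) hv1).symm⟩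

/-- The plane spanned by `φ(1, w)` and the velocity in the direction `b`. -/
def plane (w b : W) : Submodule ℂ F.ambient := Submodule.span ℂ {F.phi 1 w, F.velocity w b}

theorem mem_plane_iff {w b : W} {v : F.ambient} :
    v ∈ F.plane w b ↔ ∃ α β : ℂ, α • F.phi 1 w + β • F.velocity w b = v :=
  Submodule.mem_span_pair

theorem finrank_plane (w : W) {b : W} (hb : b ≠ 0) : finrank ℂ (F.plane w b) = 2 := by
  have hli : LinearIndependent ℂ ![F.phi 1 w, F.velocity w b] := by
    rw [LinearIndependent.pair_iff]
    intro s t hst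
    have h1 := congrArg Prod.fst hst
    have h2 := congrArg (fun v : F.ambient => v.2.1) hst
    simp at h1 h2
    subst h1
    simpa [hb] using h2
  have := finrank_span_eq_card hli
  rwa [Matrix.range_cons, Matrix.range_cons, Matrix.range_empty, Set.union_empty,
    Set.singleton_union, Fintype.card_fin] at this

variable [FiniteDimensional ℂ W] [FiniteDimensional ℂ (F.comp 2)]

/-- The line `[1 : w : ι_w^2]`, as a subspace of the embedded tangent space at this point. -/
abbrev pointInTangentSpace (w : W) :
    Submodule ℂ (embeddedTangentSpace F.variety (F.point w)) :=
  (F.point w).submodule.comap (embeddedTangentSpace F.variety (F.point w)).subtype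

/-- The isomorphism of `W` with the tangent space of the Euler-symmetric variety at
`[1 : w : ι_w^2]`, given by the differential of the parametrization. -/
def tangentEquiv (w : W) : W ≃ₗ[ℂ] TangentSpaceAt F.variety (F.point w) :=
  LinearEquiv.ofBijective
    ((F.pointInTangentSpace w).mkQ ∘ₗ
      (F.velocity w).codRestrict (embeddedTangentSpace F.variety (F.point w))
        (F.velocity_mem_embeddedTangentSpace w)) (by
    constructor
    · rw [injective_iff_map_eq_zero]
      intro b hb
      exact F.eq_zero_of_velocity_mem_submodule_point 
        ((Submodule.Quotient.mk_eq_zero (F.pointInTangentSpace w)).1 hb)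
    · intro y
      obtain ⟨⟨u, hu⟩, rfl⟩ := Submodule.Quotient.mk_surjective _ y
      refine ⟨u.2.1 - u.1 • w, ((Submodule.Quotient.eq (F.pointInTangentSpace w)).2 ?_).symm⟩
      refine F.mem_submodule_point_iff.2 ⟨u.1, ?_⟩
      exact eq_sub_of_add_eq (F.eq_add_velocity_of_mem_embeddedTangentSpace hu).symm)

/-- A direction at a general point is tangent to a line in the Euler-symmetric variety if and only
if all quadrics in `F^2` vanish on it. -/
theorem tangentEquiv_mem_affineCone_varietyOfLines_iff (w b : W) :
    F.tangentEquiv w b ∈ affineCone (varietyOfLines F.variety (F.point w)) ↔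
      ∀ q ∈ F.comp 2, evalAt b q = 0 := by
  by_cases hb : b = 0
  · subst hb
    rw [map_zero]
    refine iff_of_true (zero_mem_affineCone _) fun q hq => ?_
    simpa using evalAt_smul (F.comp_le 2 hq) 0 0
  have hb' : F.tangentEquiv w b ≠ 0 := by simpa using hb
  rw [mem_affineCone_iff_mk_mem hb']
  constructor
  · rintro ⟨L, -, hxL, hLM, hp⟩ q hq
    have h1 : F.tangentEquiv w b ∈ (Projectivization.mk ℂ (F.tangentEquiv w b) hb').submodule := by
      rw [Projectivization.submodule_mk]
      exact Submodule.mem_span_singleton_self _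
    rw [hp] at h1
    obtain ⟨⟨u, hu⟩, huL, hub⟩ := h1
    have h2 : u - F.velocity w b ∈ (F.point w).submodule :=
      (Submodule.Quotient.eq (F.pointInTangentSpace w)).1 hub
    have h3 : F.velocity w b ∈ L := by
      have := L.sub_mem huL (hxL h2)
      rwa [show (Submodule.subtype _ ⟨u, hu⟩ : F.ambient) = u from rfl, sub_sub_cancel] at this
    have h4 : F.phi 1 w ∈ L := hxL (F.mem_submodule_point_iff.2 ⟨1, one_smul ℂ (F.phi 1 w)⟩)
    refine F.evalAt_eq_zero_of_phi_one_add_velocity_mem (w := w) ?_ hq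
    have h5 : F.phi 1 w + F.velocity w b ≠ 0 := fun h => by
      have := congrArg Prod.fst h
      simp at this
    rw [mem_affineCone_iff_mk_mem h5]
    refine hLM _ ?_
    rw [Projectivization.submodule_mk, Submodule.span_singleton_le_iff_mem]
    exact L.add_mem h4 h3
  · intro hq
    refine ⟨F.plane w b, ?_, ?_, ?_, ?_⟩
    · exact F.finrank_plane w hb
    · rw [point, Projectivization.submodule_mk]
      exact Submodule.span_mono (by simp)
    · intro y hy
      induction y using Projectivization.ind with
      | h v hv =>
        rw [Projectivization.submodule_mk, Submodule.span_singleton_le_iff_mem, mem_plane_iff] at hy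
        obtain ⟨α, β, hy⟩ := hy
        rw [← mem_affineCone_iff_mk_mem hv, ← hy]
        exact F.smul_phi_one_add_smul_velocity_mem hq α β
    · refine (Projectivization.submodule_mk (F.tangentEquiv w b) hb').trans (le_antisymm ?_ ?_)
      · refine (Submodule.span_singleton_le_iff_mem _ _).2 ?_
        exact ⟨⟨F.velocity w b, F.velocity_mem_embeddedTangentSpace w b⟩,
          F.mem_plane_iff.2 ⟨0, 1, by simp⟩, rfl⟩
      · rintro _ ⟨⟨u, hu⟩, huL, rfl⟩
        have huL' := (F.mem_plane_iff (w := w) (b := b) (v := u)).1 huL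
        obtain ⟨α, β, h⟩ := huL'
        have h2 : β • F.velocity w b - u ∈ (F.point w).submodule := by
          refine F.mem_submodule_point_iff.2 ⟨-α, ?_⟩
          rw [← h, neg_smul]
          abel
        have h3 : β • F.tangentEquiv w b = Submodule.Quotient.mk ⟨u, hu⟩ :=
          (Submodule.Quotient.eq (F.pointInTangentSpace w)).2 h2
        exact Submodule.mem_span_singleton.2 ⟨β, h3⟩

/-- The variety of lines at `[1 : w : ι_w^2]` is projectively equivalent to the base locus. -/
theorem isSetTheoreticCompleteIntersection_varietyOfLines_iff (w : W) {c : ℕ}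
    {Q : Fin c → PolyRing W} (hQ : F.comp 2 = Submodule.span ℂ (Set.range Q)) :
    IsSetTheoreticCompleteIntersection (varietyOfLines F.variety (F.point w)) c ↔
      IsSetTheoreticCompleteIntersection (zeroLocus (Set.range Q)) c := by
  have h (b : W) : b ∈ affineCone (zeroLocus (Set.range Q)) ↔
      F.tangentEquiv w b ∈ affineCone (varietyOfLines F.variety (F.point w)) := by
    rw [tangentEquiv_mem_affineCone_varietyOfLines_iff, mem_affineCone_zeroLocus_iff]
    · refine ⟨fun h q hq => ?_, fun h q hq => h q (hQ ▸ Submodule.subset_span hq)⟩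
      rw [hQ] at hq
      have : Submodule.span ℂ (Set.range Q) ≤ LinearMap.ker (evalAt b).toLinearMap :=
        Submodule.span_le.2 h
      exact this hq
    · intro f hf
      exact ⟨2, one_le_two, F.comp_le 2 (hQ ▸ Submodule.subset_span hf)⟩
  constructor
  · exact fun hc => hc.of_linearEquiv (F.tangentEquiv w) h
  · refine fun hc => hc.of_linearEquiv (F.tangentEquiv w).symm fun v => ?_
    rw [h, LinearEquiv.apply_symm_apply]

/-- The open subset `t ≠ 0` of the Euler-symmetric variety is dense. -/
theorem variety_subset_zariskiClosure_diff :
    F.variety ⊆ zariskiClosure (F.variety \ zeroLocus {F.tForm}) := by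
  intro x hx f hf v hv
  have hvM : v ∈ affineCone F.variety := Or.inr ⟨x, hx, hv⟩
  refine F.mem_affineCone_variety_iff.1 hvM f (F.mem_vanishingIdeal_variety_of_tForm_mul_mem ?_)
  rintro u (rfl | ⟨y, hy, hu⟩)
  · rw [map_mul, evalAt_tForm, Prod.fst_zero, zero_mul]
  · rw [map_mul, evalAt_tForm]
    by_cases hyt : y ∈ zeroLocus {F.tForm}
    · have := hyt _ rfl u hu
      rw [evalAt_tForm] at this
      rw [this, zero_mul]
    · rw [hf u (Or.inr ⟨y, ⟨hy, hyt⟩, hu⟩), mul_zero]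

/-- A property of the points `[1 : w : ι_w^2]` that does not depend on `w` holds at a general point
if and only if it holds at these points. -/
theorem forGeneralPoint_iff {P : Projectivization ℂ F.ambient → Prop} {p : Prop}
    (h : ∀ w, P (F.point w) ↔ p) : ForGeneralPoint F.variety P ↔ p := by
  constructor
  · rintro ⟨s, hs, hP⟩
    -- Otherwise `t` would vanish on a dense subset of the variety, hence at `[1 : 0 : 0]`.
    have : ∃ x ∈ F.variety \ zeroLocus s, x ∉ zeroLocus {F.tForm} := by
      by_contra! hx
      have h1 : F.tForm ∈ vanishingIdeal (F.variety \ zeroLocus s) := by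
        rintro v (rfl | ⟨y, hy, hv⟩)
        · rw [evalAt_tForm, Prod.fst_zero]
        · exact hx y hy _ rfl v hv
      have h2 : F.point 0 ∈ F.variety :=
        (mem_affineCone_iff_mk_mem _).1 (F.phi_mem_affineCone_variety 1 0)
      have h3 := hs h2 _ h1 (F.phi 1 0) (F.mem_submodule_point_iff.2 ⟨1, one_smul ℂ (F.phi 1 0)⟩)
      rw [evalAt_tForm] at h3
      simp at h3
    obtain ⟨x, hx, ht⟩ := this
    obtain ⟨w, rfl⟩ := F.exists_eq_point hx.1 ht
    exact (h w).1 (hP _ hx)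
  · intro hp
    refine ⟨{F.tForm}, F.variety_subset_zariskiClosure_diff, ?_⟩
    rintro x ⟨hx, ht⟩
    obtain ⟨w, rfl⟩ := F.exists_eq_point hx ht
    exact (h w).2 hp

end SymbolSystem

end EulerSym

end

theorem theorem1p2 {W : Type*} [AddCommGroup W] [Module ℂ W] [FiniteDimensional ℂ W]
    (F : EulerSym.SymbolSystem W 2) (c : ℕ) (Q : Fin c → EulerSym.PolyRing W)
    (hspan : F.comp 2 = Submodule.span ℂ (Set.range Q))
    (hdim : Module.finrank ℂ (F.comp 2) = c) :
    List.TFAE [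
      EulerSym.IsCompleteIntersection F.variety c,
      EulerSym.IsSetTheoreticCompleteIntersection (EulerSym.zeroLocus (Set.range Q)) c,
      EulerSym.ForGeneralPoint F.variety (fun x =>
        EulerSym.IsSetTheoreticCompleteIntersection (EulerSym.varietyOfLines F.variety x) c),
      RingTheory.Sequence.IsWeaklyRegular (EulerSym.PolyRing W) (List.ofFn Q)] := by
  have hQ (i : Fin c) : Q i ∈ F.comp 2 := hspan ▸ Submodule.subset_span ⟨i, rfl⟩
  have hfin : FiniteDimensional ℂ (F.comp 2) := by
    rw [hspan]
    exact FiniteDimensional.span_of_finite ℂ (Set.finite_range Q)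
  have hle : ⊤ ≤ Submodule.span ℂ (Set.range fun i => (⟨Q i, hQ i⟩ : F.comp 2)) := by
    rw [← Submodule.map_le_map_iff_of_injective (F.comp 2).injective_subtype, Submodule.map_top,
      Submodule.range_subtype, Submodule.map_span, ← Set.range_comp]
    exact hspan.le
  let b := basisOfTopLeSpanOfCardEqFinrank (fun i => (⟨Q i, hQ i⟩ : F.comp 2)) hle
    ((Fintype.card_fin c).trans hdim.symm)
  have hb : (fun i => (b i : EulerSym.PolyRing W)) = Q := by
    funext i
    rw [coe_basisOfTopLeSpanOfCardEqFinrank]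
  tfae_have 1 ↔ 4 := hb ▸ F.isCompleteIntersection_variety_iff b
  tfae_have 2 ↔ 4 := EulerSym.isSetTheoreticCompleteIntersection_zeroLocus_iff fun i =>
    ⟨2, one_le_two, F.comp_le 2 (hQ i)⟩
  tfae_have 3 ↔ 2 := F.forGeneralPoint_iff fun w =>
    F.isSetTheoreticCompleteIntersection_varietyOfLines_iff w hspan
  tfae_finish
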